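/- Let $m\ge 1$ and $k\ge 1$ be integers, let $(t_i)_{i\in\mathbb Z}$ be a strictly increasing sequence of real numbers, and let $(m_i)_{i\in\mathbb Z}$ be integers with $1\le m_i\le m$. For $i\in\mathbb Z$ and $1\le l\le m_i$ let $Q_{i,l}$ be the B-spline of degree $m$ whose $m+2$ knots are, from left to right, $t_i$ repeated $l$ times, then $t_{i+1}$ repeated $m_{i+1}$ times, $t_{i+2}$ repeated $m_{i+2}$ times, and so on, until $m+2$ knots are used up. Let $R_i$ be the B-spline of degree $m$ whose $m+2$ knots are, from right to left, $t_i$ once, then $t_{i-1}$ repeated $m_{i-1}$ times, $t_{i-2}$ repeated $m_{i-2}$ times, and so on, until $m+2$ knots are used up. (B-splines are normalized by the Cox–de Boor recursion.) Let $$V=\Big\{\sum_{i\in\mathbb Z}\sum_{1\le l\le m_i}c_{i,l}Q_{i,l} : c_{i,l}\in\mathbb R\Big\},$$ where at each point only finitely many terms are non-zero, and let $S=\operatorname{span}_{\mathbb R}\{\,|f|^2\big|_{[t_0,t_k]} : f\in V\}$. Put $$\begin{aligned}\mathcal P_k=\ &\{R_1Q_{i,l} : 1\le l\le m_i,\ \operatorname{supp}Q_{i,l}\supset(t_0,t_1)\}\\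 &\cup\{Q_{i,1}Q_{j,l} : 0\le i\le k-1,\ 1\le l\le m_j,\ Q_{j,l}\ne R_{i+1},\ \operatorname{supp}Q_{j,l}\supset(t_i,t_{i+1})\}\\ &\cup\{R_{i+1}Q_{i,l} : 1\le i\le k-1,\ 1\le l\le m_i\}.\end{aligned}$$ Then the restrictions to $[t_0,t_k]$ of the elements of $\mathcal P_k$ (which are pairwise distinct) form a basis of $S$. Consequently $$\dim S=m(k+1)+1+\sum_{i=1}^{k-1}m_i=2m+1+\sum_{i=1}^{k-1}(m+m_i).$$ Moreover $S=\widetilde V|_{[t_0,t_k]}$, where $\widetilde V$ is the real spline space defined like $V$, with the same $t_i$, but with degree $2m$ in place of $m$ and multiplicities $m+m_i$ in place of $m_i$. -/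

import Mathlib

namespace SplineSquares

noncomputable section

/-- The (normalized) B-spline of degree `d` with knots `u 0 ≤ u 1 ≤ ⋯ ≤ u (d + 1)`, by the
Cox–de Boor recursion. Only the entries `u 0, …, u (d + 1)` are used, and the usual convention
that a term with denominator `0` is dropped holds because division by zero is zero. -/
def bspline : ℕ → (ℕ → ℝ) → ℝ → ℝ
  | 0, u, x => (Set.Ico (u 0) (u 1)).indicator (fun _ => 1) x
  | d + 1, u, x =>
      (x - u 0) / (u (d + 1) - u 0) * bspline d u x +
        (u (d + 2) - x) / (u (d + 2) - u 1) * bspline d (fun j => u (j + 1)) x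

/-- For `l ≥ 1`, the sequence `t i, …, t i, t (i+1), …, t (i+1), t (i+2), …` in which `t i` appears
`l` times and `t j` appears `μ j` times for every `j > i`. -/
def knotsFrom (t : ℤ → ℝ) (μ : ℤ → ℕ) : ℤ → ℕ → ℕ → ℝ
  | i, _, 0 => t i
  | i, l, j + 1 =>
      if 2 ≤ l then knotsFrom t μ i (l - 1) j else knotsFrom t μ (i + 1) (μ (i + 1)) j

/-- For `l ≥ 1`, the sequence `t i, …, t i, t (i-1), …, t (i-1), t (i-2), …` in which `t i` appears
`l` times and `t j` appears `μ j` times for every `j < i`. -/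
def knotsBack (t : ℤ → ℝ) (μ : ℤ → ℕ) : ℤ → ℕ → ℕ → ℝ
  | i, _, 0 => t i
  | i, l, j + 1 =>
      if 2 ≤ l then knotsBack t μ i (l - 1) j else knotsBack t μ (i - 1) (μ (i - 1)) j

/-- `Q_{i,l}`: the B-spline of degree `m` whose `m + 2` knots are `t i` (`l` times), followed by
`t (i+1)` (`μ (i+1)` times), `t (i+2)` (`μ (i+2)` times), … until `m + 2` knots are used up. -/
def Q (m : ℕ) (t : ℤ → ℝ) (μ : ℤ → ℕ) (i : ℤ) (l : ℕ) : ℝ → ℝ :=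
  bspline m (knotsFrom t μ i l)

/-- `R_i`: the B-spline of degree `m` whose `m + 2` knots are, from right to left, `t i` (once),
`t (i-1)` (`μ (i-1)` times), `t (i-2)` (`μ (i-2)` times), … until `m + 2` knots are used up. -/
def R (m : ℕ) (t : ℤ → ℝ) (μ : ℤ → ℕ) (i : ℤ) : ℝ → ℝ :=
  bspline m (fun j => knotsBack t μ i 1 (m + 1 - j))

/-- The real spline space of all (pointwise finite) sums `∑_{i ∈ ℤ} ∑_{1 ≤ l ≤ μ i} c_{i,l} Q_{i,l}`
with arbitrary real coefficients. -/
def splineSpace (m : ℕ) (t : ℤ → ℝ) (μ : ℤ → ℕ) : Set (ℝ → ℝ) :=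
  {f | ∃ c : ℤ → ℕ → ℝ,
    f = fun x => ∑ᶠ i : ℤ, ∑ l ∈ Finset.Icc 1 (μ i), c i l * Q m t μ i l x}

/-- `span {|f|² : f ∈ V}` on `[t 0, t k]`, where `V` is the real spline space. -/
def spanSq (m : ℕ) (t : ℤ → ℝ) (μ : ℤ → ℕ) (k : ℕ) :
    Submodule ℝ (Set.Icc (t 0) (t k) → ℝ) :=
  Submodule.span ℝ
    {g | ∃ f ∈ splineSpace m t μ, g = (Set.Icc (t 0) (t k)).domRestrict (fun x => |f x| ^ 2)}

/-- The set of products of pairs of B-splines. -/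
def prodFamily (m : ℕ) (t : ℤ → ℝ) (μ : ℤ → ℕ) (k : ℕ) : Set (ℝ → ℝ) :=
  {g | ∃ (i : ℤ) (l : ℕ), 1 ≤ l ∧ l ≤ μ i ∧
      Set.Ioo (t 0) (t 1) ⊆ tsupport (Q m t μ i l) ∧ g = R m t μ 1 * Q m t μ i l} ∪
  {g | ∃ (i j : ℤ) (l : ℕ), 0 ≤ i ∧ i ≤ (k : ℤ) - 1 ∧ 1 ≤ l ∧ l ≤ μ j ∧
      Q m t μ j l ≠ R m t μ (i + 1) ∧
      Set.Ioo (t i) (t (i + 1)) ⊆ tsupport (Q m t μ j l) ∧ g = Q m t μ i 1 * Q m t μ j l} ∪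
  {g | ∃ (i : ℤ) (l : ℕ), 1 ≤ i ∧ i ≤ (k : ℤ) - 1 ∧ 1 ≤ l ∧ l ≤ μ i ∧
      g = R m t μ (i + 1) * Q m t μ i l}

end

end SplineSquares

namespace SplineSquares

noncomputable section

/-! ### The polynomial pieces of a B-spline -/

open Polynomial

/-! On each knot interval an element of V is a polynomial of degree at most m, and at t_r the
neighbouring polynomials agree to order m + 1 - m_r. A product of two elements has degree at most 2m
and the same contact orders, which are also those of degree 2m with multiplicities m + m_r. Let W be
the space of all piecewise polynomials on [t_0, t_k] with this degree and these orders
(`smoothPieces`, `glue`). Then S ⊆ W, and by polarization S contains all products of two elements of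
V. It remains to see that P_k restricts to a basis of W and that the larger spline space restricts
onto W.

Both follow from a triangular criterion (`linearIndependent_glue`, `span_range_glue`). The family is
split into groups r = 0, …, k - 1. Group r vanishes on [t_0, t_r), is independent on (t_r, t_{r+1}),
and has as many members as the dimension of the polynomials allowed there: those divisible by (X -
t_r) to the contact order, or all of them if r = 0.

In P_k, group r consists of products with R_{r+1} or Q_{r,1}. On (t_r, t_{r+1}) these two are
nonzero multiples of the coprime polynomials (X - t_{r+1})^m and (X - t_r)^m. In a relation R_{r+1}
p + Q_{r,1} q = 0, therefore, q is a multiple of R_{r+1}, which is not among the B-splines spanning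
q; so q = 0 and p = 0 (`linearIndependent_mul_sumElim`).

Two facts on B-splines are needed: the active ones are independent on a knot interval, by Marsden's
identity (`linearIndependent_coxDeBoor`), and their contact orders follow from a residue formula for
the jump at a knot (`eval_coxDeBoor_exactlyAt`, `dvd_coxDeBoor_exactlyAt`). -/

/-- The Cox–de Boor recursion for polynomials, started from `χ (u 0) - χ (u 1)` in degree `0`. -/
def coxDeBoor : ℕ → (ℕ → ℝ) → (ℝ → ℝ) → ℝ[X]
  | 0, u, χ => C (χ (u 0) - χ (u 1))
  | d + 1, u, χ =>
      C (u (d + 1) - u 0)⁻¹ * (X - C (u 0)) * coxDeBoor d u χ +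
        C (u (d + 2) - u 1)⁻¹ * (C (u (d + 2)) - X) * coxDeBoor d (fun j => u (j + 1)) χ

/-- The indicator function of `[c, ∞)` at `a`, as a function of `c`. -/
def upTo (a c : ℝ) : ℝ := if c ≤ a then 1 else 0

/-- The indicator function of `{a}`. -/
def exactlyAt (a c : ℝ) : ℝ := if c = a then 1 else 0

/-- Linearity in `χ` makes the jump between two neighbouring pieces another instance of the
recursion, started from the indicator of a single knot. -/
lemma coxDeBoor_sub (d : ℕ) (u : ℕ → ℝ) (χ χ' : ℝ → ℝ) :
    coxDeBoor d u (fun c => χ c - χ' c) = coxDeBoor d u χ - coxDeBoor d u χ' := by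
  induction d generalizing u with
  | zero => simp only [coxDeBoor, ← C_sub]; congr 1; ring
  | succ d ih => simp only [coxDeBoor, ih]; ring

lemma coxDeBoor_congr (d : ℕ) {u v : ℕ → ℝ} {χ χ' : ℝ → ℝ} (huv : ∀ j ≤ d + 1, u j = v j)
    (h : ∀ j ≤ d + 1, χ (u j) = χ' (u j)) : coxDeBoor d u χ = coxDeBoor d v χ' := by
  induction d generalizing u v with
  | zero =>
    simp only [coxDeBoor]
    rw [h 0 (by omega), h 1 (by omega), huv 0 (by omega), huv 1 (by omega)]
  | succ d ih =>
    simp only [coxDeBoor]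
    rw [ih (fun j hj => huv j (by omega)) (fun j hj => h j (by omega)),
      ih (u := fun j => u (j + 1)) (fun j hj => huv (j + 1) (by omega))
        (fun j hj => h (j + 1) (by omega)),
      huv 0 (by omega), huv 1 (by omega), huv (d + 1) (by omega), huv (d + 2) (by omega)]

lemma coxDeBoor_const (d : ℕ) (u : ℕ → ℝ) (a : ℝ) : coxDeBoor d u (fun _ => a) = 0 := by
  induction d generalizing u with
  | zero => simp [coxDeBoor]
  | succ d ih => simp [coxDeBoor, ih]

/-- This gives the vanishing outside the support: `a = 0` to the left of all knots, `a = 1` to the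
right. -/
lemma coxDeBoor_eq_zero {d : ℕ} {u : ℕ → ℝ} {χ : ℝ → ℝ} {a : ℝ}
    (h : ∀ j ≤ d + 1, χ (u j) = a) : coxDeBoor d u χ = 0 := by
  rw [coxDeBoor_congr d (fun _ _ => rfl) (χ' := fun _ => a) h, coxDeBoor_const]

lemma coxDeBoor_mem_degreeLT (d : ℕ) (u : ℕ → ℝ) (χ : ℝ → ℝ) :
    coxDeBoor d u χ ∈ degreeLT ℝ (d + 1) := by
  suffices (coxDeBoor d u χ).degree ≤ (d : WithBot ℕ) from
    mem_degreeLT.2 (this.trans_lt (by exact_mod_cast d.lt_succ_self))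
  induction d generalizing u with
  | zero => exact degree_C_le
  | succ d ih =>
    have h : ∀ (a b c : ℝ) (p : ℝ[X]), p.degree ≤ d →
        (C a * (C b * X + C c) * p).degree ≤ ((d + 1 : ℕ) : WithBot ℕ) := by
      intro a b c p hp
      rw [mul_assoc, ← smul_eq_C_mul]
      refine (degree_smul_le _ _).trans ((degree_mul_le _ _).trans ?_)
      rw [Nat.cast_add_one, add_comm (d : WithBot ℕ)]
      exact add_le_add degree_linear_le hp
    refine (degree_add_le _ _).trans (max_le ?_ ?_)
    · have := h (u (d + 1) - u 0)⁻¹ 1 (-u 0) _ (ih u)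
      rwa [C_1, one_mul, C_neg, ← sub_eq_add_neg] at this
    · have := h (u (d + 2) - u 1)⁻¹ (-1) (u (d + 2)) _ (ih fun j => u (j + 1))
      rwa [C_neg, C_1, neg_one_mul, neg_add_eq_sub] at this

lemma bspline_congr (d : ℕ) {u v : ℕ → ℝ} (huv : ∀ j ≤ d + 1, u j = v j) :
    bspline d u = bspline d v := by
  funext x
  induction d generalizing u v with
  | zero => simp only [bspline, huv 0 (by omega), huv 1 (by omega)]
  | succ d ih =>
    simp only [bspline]
    rw [ih (fun j hj => huv j (by omega)),
      ih (u := fun j => u (j + 1)) (fun j hj => huv (j + 1) (by omega)),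
      huv 0 (by omega), huv 1 (by omega), huv (d + 1) (by omega), huv (d + 2) (by omega)]

lemma bspline_eq_eval (d : ℕ) {u : ℕ → ℝ} (hu : Monotone u) (x : ℝ) :
    bspline d u x = (coxDeBoor d u (upTo x)).eval x := by
  induction d generalizing u with
  | zero =>
    have h01 : u 0 ≤ u 1 := hu (by omega)
    simp only [bspline, coxDeBoor, upTo, eval_C, Set.indicator, Set.mem_Ico]
    by_cases h0 : u 0 ≤ x <;> by_cases h1 : u 1 ≤ x <;> simp [h0, h1, not_lt.2, not_le.1]
    exact absurd (h01.trans h1) h0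
  | succ d ih =>
    simp only [bspline, coxDeBoor, eval_add, eval_mul, eval_sub, eval_C, eval_X]
    rw [ih hu, ih (fun a b hab => hu (by omega))]
    ring

/-! ### Jumps as residues -/

/-- The linear factor `Y + a`. -/
def linSeries (a : ℝ) : LaurentSeries ℝ :=
  HahnSeries.single 1 1 + HahnSeries.C a

lemma linSeries_eq_coe (a : ℝ) : linSeries a =
    HahnSeries.ofPowerSeries ℤ ℝ (PowerSeries.X + PowerSeries.C a) := by
  simp [linSeries]

lemma linSeries_ne_zero (a : ℝ) : linSeries a ≠ 0 := by
  rw [linSeries_eq_coe]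
  intro h
  rw [map_eq_zero_iff _ HahnSeries.ofPowerSeries_injective] at h
  have := congrArg (PowerSeries.coeff 1) h
  simp [PowerSeries.coeff_X] at this

lemma linSeries_add (a b : ℝ) : linSeries (a + b) = linSeries a + HahnSeries.C b := by
  simp [linSeries, add_assoc]

lemma exists_coe_eq_inv_linSeries {a : ℝ} (ha : a ≠ 0) :
    ∃ g : PowerSeries ℝ, (linSeries a)⁻¹ = HahnSeries.ofPowerSeries ℤ ℝ g := by
  refine ⟨(PowerSeries.X + PowerSeries.C a)⁻¹, ?_⟩
  refine inv_eq_of_mul_eq_one_right ?_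
  rw [linSeries_eq_coe, ← map_mul, PowerSeries.mul_inv_cancel _ (by simpa using ha), map_one]

open scoped Classical in
-- A factor with nonzero constant term is a unit among power series; every other factor is the
-- variable itself, so one power of it per such factor clears the pole.
lemma exists_coe_eq_inv_prod {ι : Type*} (s : Finset ι) (a : ι → ℝ) :
    ∃ g : PowerSeries ℝ, HahnSeries.single (1 : ℤ) (1 : ℝ) ^ (s.filter (fun j => a j = 0)).card *
      (∏ j ∈ s, linSeries (a j))⁻¹ = HahnSeries.ofPowerSeries ℤ ℝ g := by
  induction s using Finset.induction_on with
  | empty => exact ⟨1, by simp⟩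
  | insert i s hi ih =>
    obtain ⟨g, hg⟩ := ih
    rw [Finset.prod_insert hi, mul_inv, Finset.filter_insert]
    by_cases h : a i = 0
    · refine ⟨g, ?_⟩
      have : linSeries (a i) = HahnSeries.single (1 : ℤ) (1 : ℝ) := by simp [linSeries, h]
      have h0 := linSeries_ne_zero (a i)
      rw [this] at h0
      rw [if_pos h, Finset.card_insert_of_notMem (by simp [hi]), ← hg, this, pow_succ, mul_assoc,
        mul_inv_cancel_left₀ h0]
    · obtain ⟨g', hg'⟩ := exists_coe_eq_inv_linSeries h
      refine ⟨g' * g, ?_⟩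
      rw [if_neg h, map_mul, ← hg, ← hg']
      ring

open scoped Classical in
lemma coeff_inv_prod_eq_zero {ι : Type*} (s : Finset ι) (a : ι → ℝ) {n : ℤ}
    (hn : n + (s.filter (fun j => a j = 0)).card < 0) :
    ((∏ j ∈ s, linSeries (a j))⁻¹).coeff n = 0 := by
  obtain ⟨g, hg⟩ := exists_coe_eq_inv_prod s a
  set N := (s.filter (fun j => a j = 0)).card
  have h1 : HahnSeries.single (1 : ℤ) (1 : ℝ) ^ N = HahnSeries.single (N : ℤ) (1 : ℝ) := by
    simp [HahnSeries.single_pow]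
  have h2 := HahnSeries.coeff_single_mul_add (r := (1 : ℝ))
    (x := (∏ j ∈ s, linSeries (a j))⁻¹) (a := n) (b := (N : ℤ))
  rw [← h1, hg, one_mul] at h2
  rw [← h2, PowerSeries.coeff_coe, if_pos hn]

lemma coeff_inv_linSeries (a : ℝ) :
    ((linSeries a)⁻¹).coeff (-1) = if a = 0 then 1 else 0 := by
  classical
  split_ifs with h
  · simp [linSeries, h, HahnSeries.inv_single]
  · simpa using coeff_inv_prod_eq_zero {()} (fun _ => a) (n := -1) (by simp [h])

lemma coeff_inv_linSeries_pow (a : ℝ) {n : ℕ} (hn : 2 ≤ n) :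
    ((linSeries a ^ n)⁻¹).coeff (-1) = 0 := by
  classical
  by_cases h : a = 0
  · simp only [linSeries, h, HahnSeries.single_pow, HahnSeries.inv_single, map_zero, add_zero]
    rw [HahnSeries.coeff_single_of_ne]
    simp; omega
  · simpa using coeff_inv_prod_eq_zero (Finset.range n) (fun _ => a) (n := -1) (by simp [h])

/-- The residue at `c` of `(y - x) ^ d / ∏ j ≤ d + 1, (y - u j)` as a function of `y`. -/
def knotResidue (d : ℕ) (u : ℕ → ℝ) (c x : ℝ) : ℝ :=
  (linSeries (c - x) ^ d * (∏ j ∈ Finset.range (d + 2), linSeries (c - u j))⁻¹).coeff (-1)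

/-- Expanding (Y + (c - x))^d in the local variable Y = y - c exhibits the residue as a polynomial
in x, sorted by powers of c - x. -/
lemma knotResidue_eq_sum (d : ℕ) (u : ℕ → ℝ) (c x : ℝ) :
    knotResidue d u c x = ∑ s ∈ Finset.range (d + 1), (c - x) ^ (d - s) * (d.choose s *
      ((∏ j ∈ Finset.range (d + 2), linSeries (c - u j))⁻¹).coeff (-1 - s)) := by
  rw [knotResidue, linSeries, add_pow, Finset.sum_mul, HahnSeries.coeff_sum]
  refine Finset.sum_congr rfl fun s _ => ?_
  set w := (∏ j ∈ Finset.range (d + 2), linSeries (c - u j))⁻¹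
  have h1 : HahnSeries.single (1 : ℤ) (1 : ℝ) ^ s * HahnSeries.C (c - x) ^ (d - s) *
      (d.choose s : LaurentSeries ℝ) * w =
      HahnSeries.single (s : ℤ) ((c - x) ^ (d - s) * d.choose s) * w := by
    congr 1
    rw [← map_natCast (HahnSeries.C : ℝ →+* LaurentSeries ℝ),
      ← map_pow (HahnSeries.C : ℝ →+* LaurentSeries ℝ), mul_assoc,
      ← map_mul (HahnSeries.C : ℝ →+* LaurentSeries ℝ), HahnSeries.single_pow,
      HahnSeries.C_apply, HahnSeries.single_mul_single]
    simp
  rw [h1]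
  have h2 := HahnSeries.coeff_single_mul_add (r := (c - x) ^ (d - s) * d.choose s)
    (x := w) (a := -1 - s) (b := (s : ℤ))
  rw [sub_add_cancel] at h2
  rw [h2, mul_assoc]

/-- Written in powers of y - u_0, the fraction has only exponents at most -2, and these carry no
residue. This settles the case of vanishing denominators in the recursion. -/
lemma knotResidue_of_forall_eq {d : ℕ} {u : ℕ → ℝ} (h : ∀ j ≤ d + 1, u j = u 0) (c x : ℝ) :
    knotResidue d u c x = 0 := by
  have h1 : ∏ j ∈ Finset.range (d + 2), linSeries (c - u j) = linSeries (c - u 0) ^ (d + 2) := by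
    rw [Finset.prod_congr rfl (g := fun _ => linSeries (c - u 0))
      fun j hj => by rw [h j (by simpa [Nat.lt_succ_iff] using hj)]]
    simp
  have h2 : linSeries (c - x) = linSeries (c - u 0) + HahnSeries.C (u 0 - x) := by
    rw [← linSeries_add]; congr 1; ring
  have h0 := linSeries_ne_zero (c - u 0)
  rw [knotResidue, h1, h2, add_pow, Finset.sum_mul, HahnSeries.coeff_sum]
  refine Finset.sum_eq_zero fun s hs => ?_
  have hs : s ≤ d := by simpa [Nat.lt_succ_iff] using hs
  have h3 : linSeries (c - u 0) ^ s * HahnSeries.C (u 0 - x) ^ (d - s) *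
      (d.choose s : LaurentSeries ℝ) * (linSeries (c - u 0) ^ (d + 2))⁻¹ =
      HahnSeries.C ((u 0 - x) ^ (d - s) * d.choose s) * (linSeries (c - u 0) ^ (d + 2 - s))⁻¹ := by
    rw [map_mul, map_pow, map_natCast, show d + 2 = (d + 2 - s) + s by omega, pow_add,
      Nat.add_sub_cancel]
    field_simp
  rw [h3, HahnSeries.C_mul_eq_smul, HahnSeries.coeff_smul, coeff_inv_linSeries_pow _ (by omega),
    smul_zero]

lemma inv_mul_sub_mul_knotResidue {d : ℕ} {u : ℕ → ℝ} (hu : Monotone u) (c x : ℝ) :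
    (u (d + 1) - u 0)⁻¹ * ((u 0 - u (d + 1)) * knotResidue d u c x) = -knotResidue d u c x := by
  by_cases h : u (d + 1) = u 0
  · rw [knotResidue_of_forall_eq (fun j hj => le_antisymm ((hu hj).trans h.le) (hu (by omega)))]
    simp
  · have : u (d + 1) - u 0 ≠ 0 := sub_ne_zero.2 h
    field_simp
    ring

/-- Degree 0 is the partial fraction decomposition of (u_0 - u_1) / ((y - u_0)(y - u_1)). The
induction step is the identity (u_0 - v)(y - x) = (u_0 - x)(y - v) + (x - v)(y - u_0) with v =
u_{d+2}, divided by all linear factors. -/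
lemma eval_coxDeBoor_exactlyAt (d : ℕ) {u : ℕ → ℝ} (hu : Monotone u) (c x : ℝ) :
    (coxDeBoor d u (exactlyAt c)).eval x = (u 0 - u (d + 1)) * knotResidue d u c x := by
  induction d generalizing u with
  | zero =>
    have h0 := linSeries_ne_zero (c - u 0)
    have h1 := linSeries_ne_zero (c - u 1)
    have h2 : linSeries (c - u 1) = linSeries (c - u 0) + HahnSeries.C (u 0 - u 1) := by
      rw [← linSeries_add]; congr 1; ring
    have h3 : HahnSeries.C (u 0 - u 1) * (linSeries (c - x) ^ 0 *
        (∏ j ∈ Finset.range (0 + 2), linSeries (c - u j))⁻¹) =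
        (linSeries (c - u 0))⁻¹ - (linSeries (c - u 1))⁻¹ := by
      rw [Finset.prod_range_succ, Finset.prod_range_one]
      field_simp
      rw [h2]; ring
    have h4 := congrArg (fun f => HahnSeries.coeff f (-1)) h3
    simp only [HahnSeries.C_mul_eq_smul, HahnSeries.coeff_smul, HahnSeries.coeff_sub,
      coeff_inv_linSeries, smul_eq_mul] at h4
    rw [zero_add, knotResidue, h4]
    simp only [coxDeBoor, exactlyAt, eval_C, sub_eq_zero, eq_comm]
  | succ d ih =>
    have hu' : Monotone fun j => u (j + 1) := fun a b hab => hu (by omega)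
    simp only [coxDeBoor, eval_add, eval_mul, eval_sub, eval_C, eval_X]
    rw [ih hu, ih hu']
    have e1 := inv_mul_sub_mul_knotResidue (d := d) hu c x
    have e2 := inv_mul_sub_mul_knotResidue (d := d) hu' c x
    simp only [zero_add] at e2 ⊢
    rw [mul_right_comm, e1, mul_right_comm, e2]
    simp only [knotResidue]
    set w := ∏ j ∈ Finset.range (d + 1), linSeries (c - u (j + 1)) with hw
    have hw0 : w ≠ 0 := Finset.prod_ne_zero_iff.2 fun j _ => linSeries_ne_zero _
    have h0 := linSeries_ne_zero (c - u 0)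
    have h1 := linSeries_ne_zero (c - u (d + 2))
    have p1 : ∏ j ∈ Finset.range (d + 2), linSeries (c - u j) = w * linSeries (c - u 0) :=
      Finset.prod_range_succ' _ _
    have p2 : ∏ j ∈ Finset.range (d + 2), linSeries (c - u (j + 1)) =
      w * linSeries (c - u (d + 2)) := Finset.prod_range_succ _ _
    have p3 : ∏ j ∈ Finset.range (d + 1 + 2), linSeries (c - u j) =
        w * linSeries (c - u (d + 2)) * linSeries (c - u 0) := by
      rw [Finset.prod_range_succ', p2]
    rw [p1, p2, p3]
    have key : HahnSeries.C (u 0 - u (d + 2)) * (linSeries (c - x) ^ (d + 1) *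
        (w * linSeries (c - u (d + 2)) * linSeries (c - u 0))⁻¹) =
        HahnSeries.C (u 0 - x) * (linSeries (c - x) ^ d * (w * linSeries (c - u 0))⁻¹) +
        HahnSeries.C (x - u (d + 2)) *
          (linSeries (c - x) ^ d * (w * linSeries (c - u (d + 2)))⁻¹) := by
      field_simp
      simp only [linSeries, map_sub]
      ring
    have k := congrArg (fun f => HahnSeries.coeff f (-1)) key
    simp only [HahnSeries.C_mul_eq_smul, HahnSeries.coeff_smul, HahnSeries.coeff_add,
      smul_eq_mul] at k
    rw [show d + 1 + 1 = d + 2 from rfl, k]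
    ring

lemma sub_pow_dvd_sub_pow (c : ℝ) {a b : ℕ} (h : a ≤ b) :
    (X - C c) ^ a ∣ (C c - X : ℝ[X]) ^ b := by
  rw [← neg_sub X, neg_pow]
  exact Dvd.dvd.mul_left (pow_dvd_pow _ h) _

open scoped Classical in
/-- A spline of degree `d` has `d - ν` continuous derivatives at a knot of multiplicity `ν`. -/
lemma dvd_coxDeBoor_exactlyAt (d : ℕ) {u : ℕ → ℝ} (hu : Monotone u) (c : ℝ) {ν : ℕ}
    (hν : ((Finset.range (d + 2)).filter (fun j => u j = c)).card ≤ ν) :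
    (X - C c) ^ (d + 1 - ν) ∣ coxDeBoor d u (exactlyAt c) := by
  have h : coxDeBoor d u (exactlyAt c) = C (u 0 - u (d + 1)) *
      ∑ s ∈ Finset.range (d + 1), (C c - X) ^ (d - s) * C (d.choose s *
      ((∏ j ∈ Finset.range (d + 2), linSeries (c - u j))⁻¹).coeff (-1 - s)) := by
    refine Polynomial.funext fun x => ?_
    rw [eval_coxDeBoor_exactlyAt d hu, knotResidue_eq_sum]
    simp [eval_finsetSum]
  rw [h]
  refine Dvd.dvd.mul_left (Finset.dvd_sum fun s hs => ?_) _
  have hs : s ≤ d := by simpa [Nat.lt_succ_iff] using hs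
  -- For s < ν the exponent d - s is large enough; for s ≥ ν the coefficient at -1 - s lies below
  -- the pole order.
  by_cases hsν : s < ν
  · exact Dvd.dvd.mul_right (sub_pow_dvd_sub_pow c (by omega)) _
  · rw [coeff_inv_prod_eq_zero]
    · simp
    · have : (Finset.range (d + 2)).filter (fun j => c - u j = 0) =
          (Finset.range (d + 2)).filter (fun j => u j = c) := by
        refine Finset.filter_congr fun j _ => ?_
        rw [sub_eq_zero, eq_comm]
      rw [this]
      omega

/-! ### Marsden's identity -/

lemma marsden (d : ℕ) {τ : ℕ → ℝ} (hτ : Monotone τ) {a : ℝ} (h1 : τ d ≤ a) (h2 : a < τ (d + 1))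
    (y : ℝ) :
    ∑ n ∈ Finset.range (d + 1), C (∏ i ∈ Finset.range d, (y - τ (n + i + 1))) *
      coxDeBoor d (fun j => τ (n + j)) (upTo a) = (C y - X) ^ d := by
  induction d generalizing τ with
  | zero => 
    have h3 : ¬ τ 1 ≤ a := h2.not_ge
    rw [Finset.sum_range_one]
    simp [coxDeBoor, upTo, h1, h3]
  | succ d ih =>
    have hτ' : Monotone fun j => τ (j + 1) := fun a b hab => hτ (by omega)
    rw [pow_succ, ← ih hτ' h1 h2]
    set P : ℕ → ℝ[X] := fun n => coxDeBoor d (fun j => τ (n + j)) (upTo a) with hP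
    -- The outermost two of the d + 3 B-splines of degree d do not reach the interval, so both sums
    -- run over the same d + 1 terms.
    have hP0 : P 0 = 0 := coxDeBoor_eq_zero (a := 1) fun j hj => by
      simp only [upTo, zero_add]
      rw [if_pos ((hτ hj).trans h1)]
    have hPe : P (d + 2) = 0 := coxDeBoor_eq_zero (a := 0) fun j hj => by
      simp only [upTo]
      rw [if_neg (not_le.2 (h2.trans_le (hτ (by omega))))]
    have hstep : ∀ n, coxDeBoor (d + 1) (fun j => τ (n + j)) (upTo a) =
        C (τ (n + d + 1) - τ n)⁻¹ * (X - C (τ n)) * P n +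
        C (τ (n + d + 2) - τ (n + 1))⁻¹ * (C (τ (n + d + 2)) - X) * P (n + 1) := by
      intro n
      simp only [coxDeBoor, hP]
      have : (fun j => τ (n + (j + 1))) = fun j => τ (n + 1 + j) := by
        funext j; congr 1; ring
      rw [this]; rfl
    simp only [hstep, mul_add, Finset.sum_add_distrib]
    rw [Finset.sum_range_succ', Finset.sum_range_succ _ (d + 1), hP0, hPe]
    simp only [mul_zero, add_zero, Finset.sum_mul]
    rw [← Finset.sum_add_distrib]
    refine Finset.sum_congr rfl fun n hn => ?_
    have hn : n ≤ d := by simpa [Nat.lt_succ_iff] using hn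
    have hlt : τ (n + 1) < τ (n + d + 2) :=
      ((hτ (by omega)).trans h1).trans_lt (h2.trans_le (hτ (by omega)))
    have hP' : coxDeBoor d (fun j => τ (n + j + 1)) (upTo a) = P (n + 1) := by
      simp only [hP]; congr 1; funext j; congr 1; ring
    rw [hP', Finset.prod_range_succ, Finset.prod_range_succ']
    have hi : ∀ i, n + 1 + i + 1 = n + i + 1 + 1 := fun i => by ring
    have hi' : ∀ i, n + (i + 1) + 1 = n + i + 1 + 1 := fun i => by ring
    simp only [hi, hi', add_zero, show n + d + 1 + 1 = n + d + 2 by ring]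
    have hinv : C (τ (n + d + 2) - τ (n + 1))⁻¹ * (C (τ (n + d + 2)) - C (τ (n + 1))) = 1 := by
      rw [← C_sub, ← C_mul, inv_mul_cancel₀ (sub_ne_zero.2 hlt.ne'), C_1]
    -- With a = τ_{n+1} and b = τ_{n+d+2}, the two contributions combine by (X - a)(y - b) + (b -
    -- X)(y - a) = (b - a)(y - X).
    simp only [C_mul, C_sub]
    linear_combination (C (∏ i ∈ Finset.range d, (y - τ (n + i + 1 + 1)))) * P (n + 1) *
      (C y - X) * hinv

/-- Modulo U, every linear functional turns the sum into a real polynomial in y that vanishes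
identically, so its coefficients are zero. -/
lemma mem_of_forall_sum_pow_smul_mem {V : Type*} [AddCommGroup V] [Module ℝ V]
    (U : Submodule ℝ V) {N : ℕ} (w : ℕ → V)
    (h : ∀ y : ℝ, ∑ s ∈ Finset.range N, y ^ s • w s ∈ U) {s : ℕ} (hs : s < N) : w s ∈ U := by
  rw [← Submodule.Quotient.mk_eq_zero, ← Module.forall_dual_apply_eq_zero_iff ℝ]
  intro φ
  have h0 : ∑ s ∈ Finset.range N, C (φ (Submodule.Quotient.mk (w s))) * X ^ s = (0 : ℝ[X]) := by
    refine Polynomial.funext fun y => ?_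
    have h1 := (Submodule.Quotient.mk_eq_zero U).2 (h y)
    have h2 := congrArg φ h1
    rw [← Submodule.mkQ_apply, map_sum, map_sum, map_zero] at h2
    rw [eval_finsetSum, eval_zero, ← h2]
    refine Finset.sum_congr rfl fun s _ => ?_
    rw [map_smul, map_smul, eval_mul, eval_C, eval_pow, eval_X, smul_eq_mul, mul_comm]
    rfl
  have h3 := congrArg (fun p => coeff p s) h0
  simp only [finsetSum_coeff, coeff_C_mul, coeff_X_pow, coeff_zero] at h3
  simpa [hs] using h3

lemma degreeLT_le_of_forall_pow_mem (d : ℕ) (U : Submodule ℝ ℝ[X])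
    (h : ∀ y : ℝ, (C y - X) ^ d ∈ U) : degreeLT ℝ (d + 1) ≤ U := by
  classical
  rw [degreeLT_eq_span_X_pow, Submodule.span_le]
  intro p hp
  obtain ⟨s, hs, rfl⟩ := by simpa using hp
  have h1 := mem_of_forall_sum_pow_smul_mem U (N := d + 1)
    (fun s => ((d.choose s : ℝ) * (-1) ^ (d - s)) • (X : ℝ[X]) ^ (d - s)) (fun y => by
      convert h y using 1
      rw [sub_eq_add_neg, add_pow]
      refine Finset.sum_congr rfl fun s _ => ?_
      rw [neg_pow (X : ℝ[X]), smul_smul, smul_eq_C_mul]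
      simp only [map_mul, map_pow, map_neg, C_1, map_natCast]
      ring) (s := d - s) (by omega)
  simp only [show d - (d - s) = s by omega] at h1
  rwa [U.smul_mem_iff] at h1
  have : (d.choose (d - s) : ℝ) ≠ 0 := by
    exact_mod_cast (Nat.choose_pos (by omega)).ne'
  exact mul_ne_zero this (pow_ne_zero _ (by norm_num))

instance finiteDimensional_degreeLT (n : ℕ) : FiniteDimensional ℝ (degreeLT ℝ n) :=
  (degreeLTEquiv ℝ n).symm.finiteDimensional

lemma finrank_degreeLT_eq (n : ℕ) : Module.finrank ℝ (degreeLT ℝ n) = n := by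
  simpa using (degreeLTEquiv ℝ n).finrank_eq

lemma span_coxDeBoor (d : ℕ) {τ : ℕ → ℝ} (hτ : Monotone τ) {a : ℝ} (h1 : τ d ≤ a)
    (h2 : a < τ (d + 1)) :
    Submodule.span ℝ (Set.range fun n : Fin (d + 1) =>
      coxDeBoor d (fun j => τ (n + j)) (upTo a)) = degreeLT ℝ (d + 1) := by
  refine le_antisymm (Submodule.span_le.2 ?_) (degreeLT_le_of_forall_pow_mem d _ fun y => ?_)
  · rintro _ ⟨n, rfl⟩
    exact coxDeBoor_mem_degreeLT _ _ _
  · rw [← marsden d hτ h1 h2 y]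
    refine Submodule.sum_mem _ fun n hn => ?_
    rw [← smul_eq_C_mul]
    exact Submodule.smul_mem _ _ (Submodule.subset_span ⟨⟨n, Finset.mem_range.1 hn⟩, rfl⟩)

/-- The pieces of the `d + 1` active B-splines on a knot interval are linearly independent. -/
lemma linearIndependent_coxDeBoor (d : ℕ) {τ : ℕ → ℝ} (hτ : Monotone τ) {a : ℝ} (h1 : τ d ≤ a)
    (h2 : a < τ (d + 1)) :
    LinearIndependent ℝ fun n : Fin (d + 1) => coxDeBoor d (fun j => τ (n + j)) (upTo a) := by
  rw [linearIndependent_iff_card_eq_finrank_span, Set.finrank, span_coxDeBoor d hτ h1 h2,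
    finrank_degreeLT_eq, Fintype.card_fin]

/-! ### Enumeration of the knots -/

/-- The knot index following `p`; the index `(i, l)` stands for a copy of `t i` that is followed by
`l - 1` further copies. -/
def nextKnot (ν : ℤ → ℕ) (p : ℤ × ℕ) : ℤ × ℕ :=
  if 2 ≤ p.2 then (p.1, p.2 - 1) else (p.1 + 1, ν (p.1 + 1))

/-- The knot index preceding `p`. -/
def prevKnot (ν : ℤ → ℕ) (p : ℤ × ℕ) : ℤ × ℕ :=
  if p.2 < ν p.1 then (p.1, p.2 + 1) else (p.1 - 1, 1)

/-- The pair `p` is an index of a knot, and of the B-spline starting there. -/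
def IsKnot (ν : ℤ → ℕ) (p : ℤ × ℕ) : Prop := 1 ≤ p.2 ∧ p.2 ≤ ν p.1

/-- The knots from index `p` on. -/
def knots (t : ℤ → ℝ) (ν : ℤ → ℕ) (p : ℤ × ℕ) (j : ℕ) : ℝ := t ((nextKnot ν)^[j] p).1

/-- The index `n` places before the last copy of `t r`. For `n ≤ d`, these are the B-splines of
degree `d` that are active on `(t r, t (r + 1))`. -/
def activeIdx (ν : ℤ → ℕ) (r : ℤ) (n : ℕ) : ℤ × ℕ := (prevKnot ν)^[n] (r, 1)

/-- The polynomial that agrees with a B-spline on `[t r, t (r + 1))`. -/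
def piece (d : ℕ) (t : ℤ → ℝ) (ν : ℤ → ℕ) (p : ℤ × ℕ) (r : ℤ) : ℝ[X] :=
  coxDeBoor d (knots t ν p) (upTo (t r))

lemma knotsFrom_eq_knots (t : ℤ → ℝ) (ν : ℤ → ℕ) (i : ℤ) (l : ℕ) :
    knotsFrom t ν i l = knots t ν (i, l) := by
  funext j
  induction j generalizing i l with
  | zero => simp [knotsFrom, knots]
  | succ j ih =>
    simp only [knotsFrom, knots, Function.iterate_succ_apply, nextKnot]
    split_ifs <;> simp [ih, knots]

section
variable {ν : ℤ → ℕ}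

lemma isKnot_one (hν : ∀ i, 1 ≤ ν i) (r : ℤ) : IsKnot ν (r, 1) := ⟨le_rfl, hν r⟩

lemma IsKnot.next (hν : ∀ i, 1 ≤ ν i) {p : ℤ × ℕ} (hp : IsKnot ν p) : IsKnot ν (nextKnot ν p) := by
  obtain ⟨h1, h2⟩ := hp
  unfold nextKnot
  split_ifs with h
  · exact ⟨by dsimp only; omega, by dsimp only; omega⟩
  · exact ⟨hν _, le_rfl⟩

lemma isKnot_prev (hν : ∀ i, 1 ≤ ν i) (p : ℤ × ℕ) : IsKnot ν (prevKnot ν p) := by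
  unfold prevKnot
  split_ifs with h
  · exact ⟨by dsimp only; omega, by dsimp only; omega⟩
  · exact ⟨le_rfl, hν _⟩

lemma IsKnot.iterate_next (hν : ∀ i, 1 ≤ ν i) {p : ℤ × ℕ} (hp : IsKnot ν p) (n : ℕ) :
    IsKnot ν ((nextKnot ν)^[n] p) := by
  induction n with
  | zero => exact hp
  | succ n ih => rw [Function.iterate_succ_apply']; exact ih.next hν

lemma isKnot_activeIdx (hν : ∀ i, 1 ≤ ν i) (r : ℤ) (n : ℕ) : IsKnot ν (activeIdx ν r n) := by
  cases n with
  | zero => exact isKnot_one hν r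
  | succ n => rw [activeIdx, Function.iterate_succ_apply']; exact isKnot_prev hν _

lemma IsKnot.next_prev {p : ℤ × ℕ} (hp : IsKnot ν p) : nextKnot ν (prevKnot ν p) = p := by
  obtain ⟨i, l⟩ := p
  obtain ⟨h1, h2⟩ := hp
  dsimp only at h1 h2
  unfold prevKnot
  split_ifs with h
  · simp only [nextKnot]
    rw [if_pos (by omega)]; simp
  · simp only [nextKnot] at h ⊢
    rw [if_neg (by omega)]; simp; omega

lemma IsKnot.prev_next {p : ℤ × ℕ} (hp : IsKnot ν p) : prevKnot ν (nextKnot ν p) = p := by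
  obtain ⟨i, l⟩ := p
  obtain ⟨h1, h2⟩ := hp
  dsimp only at h1 h2
  unfold nextKnot
  split_ifs with h
  · simp only [prevKnot]
    rw [if_pos (by omega)]
    simp only [Prod.mk.injEq, true_and]; omega
  · simp only [prevKnot] at h ⊢
    rw [if_neg (by omega)]; simp; omega

lemma next_activeIdx_succ (hν : ∀ i, 1 ≤ ν i) (r : ℤ) (n : ℕ) :
    nextKnot ν (activeIdx ν r (n + 1)) = activeIdx ν r n := by
  rw [activeIdx, Function.iterate_succ_apply']
  exact (isKnot_activeIdx hν r n).next_prev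

lemma iterate_next_activeIdx (hν : ∀ i, 1 ≤ ν i) (r : ℤ) {n j : ℕ} (hj : j ≤ n) :
    (nextKnot ν)^[j] (activeIdx ν r n) = activeIdx ν r (n - j) := by
  induction j with
  | zero => rfl
  | succ j ih =>
    rw [Function.iterate_succ_apply', ih (by omega), show n - j = n - (j + 1) + 1 by omega,
      next_activeIdx_succ hν]

lemma next_activeIdx_zero (r : ℤ) : nextKnot ν (activeIdx ν r 0) = (r + 1, ν (r + 1)) := by
  simp [activeIdx, nextKnot]

lemma iterate_succ_next_activeIdx (hν : ∀ i, 1 ≤ ν i) (r : ℤ) (n : ℕ) :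
    (nextKnot ν)^[n + 1] (activeIdx ν r n) = (r + 1, ν (r + 1)) := by
  rw [Function.iterate_succ_apply', iterate_next_activeIdx hν r le_rfl, Nat.sub_self,
    next_activeIdx_zero]

lemma IsKnot.eq_activeIdx {p : ℤ × ℕ} (hν : ∀ i, 1 ≤ ν i) (hp : IsKnot ν p) {r : ℤ} {n : ℕ}
    (h : (nextKnot ν)^[n] p = (r, 1)) : p = activeIdx ν r n := by
  induction n generalizing p with
  | zero => exact h
  | succ n ih =>
    rw [activeIdx, Function.iterate_succ_apply', ← activeIdx, ← ih (hp.next hν) h, hp.prev_next]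

lemma fst_le_next (p : ℤ × ℕ) : p.1 ≤ (nextKnot ν p).1 := by
  unfold nextKnot; split_ifs <;> simp

lemma next_fst_le (p : ℤ × ℕ) : (nextKnot ν p).1 ≤ p.1 + 1 := by
  unfold nextKnot; split_ifs <;> simp

lemma monotone_iterate_next (p : ℤ × ℕ) : Monotone fun n => ((nextKnot ν)^[n] p).1 :=
  monotone_nat_of_le_succ fun n => by
    rw [Function.iterate_succ_apply']; exact fst_le_next _

lemma iterate_next_fst_le (p : ℤ × ℕ) (n : ℕ) : ((nextKnot ν)^[n] p).1 ≤ p.1 + n := by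
  induction n with
  | zero => simp
  | succ n ih =>
    rw [Function.iterate_succ_apply']
    have := next_fst_le (ν := ν) ((nextKnot ν)^[n] p)
    push_cast; omega

lemma activeIdx_fst_le (r : ℤ) (n : ℕ) : (activeIdx ν r n).1 ≤ r := by
  induction n with
  | zero => simp [activeIdx]
  | succ n ih =>
    rw [activeIdx, Function.iterate_succ_apply', ← activeIdx, prevKnot]
    split_ifs <;> dsimp only <;> omega

lemma activeIdx_of_lt {r : ℤ} {n : ℕ} (hn : n < ν r) : activeIdx ν r n = (r, n + 1) := by
  induction n with
  | zero => simp [activeIdx]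
  | succ n ih =>
    rw [activeIdx, Function.iterate_succ_apply', ← activeIdx, ih (by omega), prevKnot, if_pos hn]

lemma snd_add_of_iterate_next_fst_eq {p : ℤ × ℕ} {n : ℕ}
    (h : ((nextKnot ν)^[n] p).1 = p.1) : ((nextKnot ν)^[n] p).2 + n = p.2 := by
  induction n with
  | zero => simp
  | succ n ih =>
    have h1 : p.1 ≤ ((nextKnot ν)^[n] p).1 := monotone_iterate_next p n.zero_le
    have h2 := fst_le_next (ν := ν) ((nextKnot ν)^[n] p)
    rw [Function.iterate_succ_apply'] at h ⊢
    have ih := ih (by omega)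
    rw [nextKnot] at h ⊢
    split_ifs at h ⊢ <;> dsimp only at * <;> omega

/-- Along a run of equal knots the second component strictly decreases, so it labels the copies
injectively by 1, …, ν r. -/
lemma card_filter_iterate_next_le (hν : ∀ i, 1 ≤ ν i) {p : ℤ × ℕ} (hp : IsKnot ν p) (r : ℤ)
    (N : ℕ) : ((Finset.range N).filter fun j => ((nextKnot ν)^[j] p).1 = r).card ≤ ν r := by
  have h : ∀ j j', ((nextKnot ν)^[j] p).1 = r → ((nextKnot ν)^[j'] p).1 = r → j ≤ j' →
      ((nextKnot ν)^[j] p).2 = ((nextKnot ν)^[j'] p).2 → j = j' := by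
    intro j j' h1 h2 hjj' h3
    obtain ⟨n, rfl⟩ := Nat.exists_eq_add_of_le hjj'
    rw [add_comm, Function.iterate_add_apply] at h2 h3
    have := snd_add_of_iterate_next_fst_eq (h2.trans h1.symm)
    omega
  refine (Finset.card_le_card_of_injOn (t := Finset.Icc 1 (ν r))
    (fun j => ((nextKnot ν)^[j] p).2) ?_ ?_).trans (by simp)
  · intro j hj
    have hj := (Finset.mem_filter.1 hj).2
    have := hp.iterate_next hν j
    rw [IsKnot, hj] at this
    simpa using this
  · intro j hj j' hj' hjj'
    have hj := (Finset.mem_filter.1 hj).2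
    have hj' := (Finset.mem_filter.1 hj').2
    rcases le_total j j' with hle | hle
    · exact h j j' hj hj' hle hjj'
    · exact (h j' j hj' hj hle hjj'.symm).symm

/-- Backward indices count the copies still to come on the left, forward indices those on the right;
hence the reflection l ↦ ν i + 1 - l. -/
lemma knotsBack_eq (hν : ∀ i, 1 ≤ ν i) (t : ℤ → ℝ) (i : ℤ) (l : ℕ) (hl : 1 ≤ l) (hl' : l ≤ ν i)
    (j : ℕ) : knotsBack t ν i l j = t ((prevKnot ν)^[j] (i, ν i + 1 - l)).1 := by
  induction j generalizing i l with
  | zero => simp [knotsBack]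
  | succ j ih =>
    simp only [knotsBack, Function.iterate_succ_apply, prevKnot]
    by_cases h : 2 ≤ l
    · rw [if_pos h, if_pos (by omega), ih _ _ (by omega) (by omega),
        show ν i + 1 - (l - 1) = ν i + 1 - l + 1 by omega]
    · rw [if_neg h, if_neg (by omega), ih _ _ (hν _) le_rfl, Nat.add_sub_cancel_left]

end

/-! ### B-splines on the knot intervals -/

section
variable {d : ℕ} {t : ℤ → ℝ} {ν : ℤ → ℕ}

/-- R_{r+1} is the leftmost B-spline still active on (t_r, t_{r+1}): its last knot is the first copy
of t_{r+1}, so its first one lies d places before the last copy of t_r. -/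
lemma R_eq_Q (hν : ∀ i, 1 ≤ ν i) (d : ℕ) (t : ℤ → ℝ) (r : ℤ) :
    R d t ν (r + 1) = Q d t ν (activeIdx ν r d).1 (activeIdx ν r d).2 := by
  rw [R, Q, knotsFrom_eq_knots]
  refine bspline_congr d fun j hj => ?_
  rw [knotsBack_eq hν t _ _ le_rfl (hν _), Nat.add_sub_cancel, knots]
  rcases Nat.lt_or_ge d j with h | h
  · obtain rfl : j = d + 1 := by omega
    rw [iterate_succ_next_activeIdx hν]
    simp
  · rw [iterate_next_activeIdx hν r h, show d + 1 - j = d - j + 1 by omega,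
      Function.iterate_succ_apply]
    simp [prevKnot, activeIdx]

lemma monotone_knots (ht : StrictMono t) (p : ℤ × ℕ) : Monotone (knots t ν p) :=
  fun _ _ h => ht.monotone (monotone_iterate_next p h)

lemma Q_eq_eval_piece (ht : StrictMono t) {i r : ℤ} {l : ℕ} {x : ℝ}
    (hx : x ∈ Set.Ico (t r) (t (r + 1))) :
    Q d t ν i l x = (piece d t ν (i, l) r).eval x := by
  rw [Q, knotsFrom_eq_knots, bspline_eq_eval d (monotone_knots ht _), piece]
  congr 1
  refine coxDeBoor_congr d (fun _ _ => rfl) fun j _ => ?_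
  rw [knots, upTo, upTo]
  refine if_congr ?_ rfl rfl
  rw [ht.le_iff_le]
  refine ⟨fun h => ?_, fun h => (ht.monotone h).trans hx.1⟩
  exact Int.lt_add_one_iff.1 (ht.lt_iff_lt.1 (h.trans_lt hx.2))

lemma piece_mem_degreeLT (d : ℕ) (t : ℤ → ℝ) (ν : ℤ → ℕ) (p : ℤ × ℕ) (r : ℤ) :
    piece d t ν p r ∈ degreeLT ℝ (d + 1) := coxDeBoor_mem_degreeLT _ _ _

lemma piece_eq_zero_of_lt (ht : StrictMono t) {p : ℤ × ℕ} {r : ℤ} (h : r < p.1) :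
    piece d t ν p r = 0 := by
  refine coxDeBoor_eq_zero (a := 0) fun j _ => if_neg (not_le.2 (ht ?_))
  exact h.trans_le (monotone_iterate_next p j.zero_le)

lemma piece_eq_zero_of_le (ht : StrictMono t) {p : ℤ × ℕ} {r : ℤ}
    (h : ((nextKnot ν)^[d + 1] p).1 ≤ r) : piece d t ν p r = 0 :=
  coxDeBoor_eq_zero (a := 1) fun _ hj =>
    if_pos (ht.monotone ((monotone_iterate_next p hj).trans h))

lemma piece_eq_zero_of_add_le (ht : StrictMono t) {p : ℤ × ℕ} {r : ℤ}
    (h : p.1 + (d + 1) ≤ r) : piece d t ν p r = 0 := by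
  have := iterate_next_fst_le (ν := ν) p (d + 1)
  push_cast at this
  exact piece_eq_zero_of_le ht (this.trans h)

lemma dvd_piece_sub_of_card_le (ht : StrictMono t) (p : ℤ × ℕ) (r : ℤ) {N : ℕ}
    (hN : ((Finset.range (d + 2)).filter fun j => ((nextKnot ν)^[j] p).1 = r).card ≤ N) :
    (X - C (t r)) ^ (d + 1 - N) ∣ piece d t ν p r - piece d t ν p (r - 1) := by
  classical
  rw [piece, piece, ← coxDeBoor_sub]
  rw [coxDeBoor_congr d (v := knots t ν p) (χ' := exactlyAt (t r)) (fun _ _ => rfl)]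
  · refine dvd_coxDeBoor_exactlyAt d (monotone_knots ht p) _ ?_
    convert hN using 3
    exact ht.injective.eq_iff
  · intro j _
    simp only [knots, upTo, exactlyAt, ht.le_iff_le, ht.injective.eq_iff]
    set s := ((nextKnot ν)^[j] p).1
    rcases lt_trichotomy s r with h | h | h
    · rw [if_pos h.le, if_pos (by omega), if_neg h.ne, sub_self]
    · rw [if_pos h.le, if_neg (by omega), if_pos h, sub_zero]
    · rw [if_neg (by omega), if_neg (by omega), if_neg h.ne', sub_self]

lemma dvd_piece_sub (ht : StrictMono t) (hν : ∀ i, 1 ≤ ν i) {p : ℤ × ℕ} (hp : IsKnot ν p) (r : ℤ) :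
    (X - C (t r)) ^ (d + 1 - ν r) ∣ piece d t ν p r - piece d t ν p (r - 1) :=
  dvd_piece_sub_of_card_le ht p r (card_filter_iterate_next_le hν hp r _)

/-- A nonzero piece forces the knots to start at or before t_r and to end after it. The step that
first passes t_r leaves from its last copy `(r, 1)`, and n counts the steps up to there. -/
lemma exists_eq_activeIdx (ht : StrictMono t) (hν : ∀ i, 1 ≤ ν i) {p : ℤ × ℕ} (hp : IsKnot ν p)
    {r : ℤ} (h : piece d t ν p r ≠ 0) : ∃ n ≤ d, p = activeIdx ν r n := by
  have h1 : p.1 ≤ r := not_lt.1 fun hlt => h (piece_eq_zero_of_lt ht hlt)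
  have h2 : r < ((nextKnot ν)^[d + 1] p).1 := not_le.1 fun hle => h (piece_eq_zero_of_le ht hle)
  have hex : ∃ n, r < ((nextKnot ν)^[n] p).1 := ⟨_, h2⟩
  classical
  obtain ⟨n, hn⟩ : ∃ n, Nat.find hex = n + 1 := Nat.exists_eq_succ_of_ne_zero fun h0 => by
    have := Nat.find_spec hex
    rw [h0, Function.iterate_zero, id] at this
    omega
  have h3 := Nat.find_spec hex
  have h4 := Nat.find_min hex (m := n) (by omega)
  have h5 := Nat.find_min' hex h2
  rw [hn, Function.iterate_succ_apply'] at h3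
  refine ⟨n, by omega, hp.eq_activeIdx hν ?_⟩
  have h6 := hp.iterate_next hν n
  set q := (nextKnot ν)^[n] p
  rw [nextKnot] at h3
  obtain ⟨h7, h8⟩ := h6
  split_ifs at h3 with hq
  · exact absurd h3 h4
  · ext <;> dsimp only at * <;> omega

/-- The active B-splines are linearly independent on a knot interval. -/
lemma linearIndependent_piece (ht : StrictMono t) (hν : ∀ i, 1 ≤ ν i) (d : ℕ) (r : ℤ) :
    LinearIndependent ℝ fun n : Fin (d + 1) => piece d t ν (activeIdx ν r n) r := by
  have h := linearIndependent_coxDeBoor d (τ := knots t ν (activeIdx ν r d)) (a := t r)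
    (monotone_knots ht _)
    (by rw [knots, iterate_next_activeIdx hν r le_rfl]; simp [activeIdx])
    (by rw [knots, iterate_succ_next_activeIdx hν]; exact ht (by simp))
  -- Marsden's identity numbers the active B-splines from left to right, `activeIdx` from right to
  -- left.
  convert h.comp Fin.rev Fin.rev_injective using 1
  funext n
  have hn : (n : ℕ) ≤ d := Nat.lt_succ_iff.1 n.2
  simp only [Function.comp, piece]
  congr 1
  funext j
  rw [knots, knots, add_comm (n.rev : ℕ) j, Function.iterate_add_apply,
    iterate_next_activeIdx hν r (Nat.lt_succ_iff.1 n.rev.2),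
    show d - (n.rev : ℕ) = n by rw [Fin.val_rev]; omega]

lemma piece_activeIdx_ne_zero (ht : StrictMono t) (hν : ∀ i, 1 ≤ ν i) (r : ℤ) {n : ℕ} (hn : n ≤ d) :
    piece d t ν (activeIdx ν r n) r ≠ 0 :=
  (linearIndependent_piece ht hν d r).ne_zero ⟨n, Nat.lt_succ_of_le hn⟩

lemma activeIdx_piece_injective (ht : StrictMono t) (hν : ∀ i, 1 ≤ ν i) (r : ℤ) {n n' : ℕ}
    (hn : n ≤ d) (hn' : n' ≤ d)
    (h : piece d t ν (activeIdx ν r n) r = piece d t ν (activeIdx ν r n') r) : n = n' := by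
  simpa using (linearIndependent_piece ht hν d r).injective
    (a₁ := ⟨n, Nat.lt_succ_of_le hn⟩) (a₂ := ⟨n', Nat.lt_succ_of_le hn'⟩) h

lemma eq_smul_of_pow_dvd {c : ℝ} {p : ℝ[X]} (hp : p ∈ degreeLT ℝ (d + 1)) (hp0 : p ≠ 0)
    (h : (X - C c) ^ d ∣ p) : ∃ a : ℝ, a ≠ 0 ∧ p = a • (X - C c) ^ d := by
  obtain ⟨q, rfl⟩ := h
  have hq0 : q ≠ 0 := right_ne_zero_of_mul hp0
  rw [mem_degreeLT, degree_mul, degree_pow, degree_X_sub_C, degree_eq_natDegree hq0] at hp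
  have : q.natDegree = 0 := by
    simp only [nsmul_eq_mul, mul_one] at hp
    have hp : d + q.natDegree < d + 1 := by exact_mod_cast hp
    omega
  obtain ⟨a, rfl⟩ := natDegree_eq_zero.1 this
  exact ⟨a, by simpa using hq0, by rw [smul_eq_C_mul, mul_comm]⟩

/-- This is Q_{r,1}: its knot t_r is simple and the piece before it is zero, so the piece itself is
the jump and is divisible by (X - t_r)^d. `piece_activeIdx_last` is the mirror image for R_{r+1}. -/
lemma piece_activeIdx_zero (ht : StrictMono t) (hν : ∀ i, 1 ≤ ν i) (d : ℕ) (r : ℤ) :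
    ∃ a : ℝ, a ≠ 0 ∧ piece d t ν (activeIdx ν r 0) r = a • (X - C (t r)) ^ d := by
  refine eq_smul_of_pow_dvd (piece_mem_degreeLT _ _ _ _ _)
    (piece_activeIdx_ne_zero ht hν r d.zero_le) ?_
  have h := dvd_piece_sub_of_card_le (d := d) (ν := ν) (N := 1) ht (activeIdx ν r 0) r ?_
  · rwa [Nat.add_sub_cancel, piece_eq_zero_of_lt ht (r := r - 1) (by simp [activeIdx]),
      sub_zero] at h
  · rw [Finset.card_le_one]
    have : ∀ j, ((nextKnot ν)^[j] (activeIdx ν r 0)).1 = r → j = 0 := by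
      intro j hj
      by_contra h0
      have h1 : ((nextKnot ν)^[1] (activeIdx ν r 0)).1 ≤ _ :=
        monotone_iterate_next _ (Nat.one_le_iff_ne_zero.2 h0)
      rw [iterate_succ_next_activeIdx hν] at h1
      dsimp only at h1
      omega
    intro a ha b hb
    rw [this a (Finset.mem_filter.1 ha).2, this b (Finset.mem_filter.1 hb).2]

lemma piece_activeIdx_last (ht : StrictMono t) (hν : ∀ i, 1 ≤ ν i) (d : ℕ) (r : ℤ) :
    ∃ a : ℝ, a ≠ 0 ∧ piece d t ν (activeIdx ν r d) r = a • (X - C (t (r + 1))) ^ d := by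
  refine eq_smul_of_pow_dvd (piece_mem_degreeLT _ _ _ _ _)
    (piece_activeIdx_ne_zero ht hν r le_rfl) ?_
  have h := dvd_piece_sub_of_card_le (d := d) (ν := ν) (N := 1) ht (activeIdx ν r d) (r + 1) ?_
  · rwa [Nat.add_sub_cancel, piece_eq_zero_of_le ht
      (by rw [iterate_succ_next_activeIdx hν]), zero_sub, dvd_neg, add_sub_cancel_right] at h
  · rw [Finset.card_le_one]
    have : ∀ j, j ∈ (Finset.range (d + 2)).filter
        (fun j => ((nextKnot ν)^[j] (activeIdx ν r d)).1 = r + 1) → j = d + 1 := by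
      intro j hj
      rw [Finset.mem_filter, Finset.mem_range] at hj
      by_contra h0
      have h1 := hj.2
      rw [iterate_next_activeIdx hν r (by omega)] at h1
      have := activeIdx_fst_le (ν := ν) r (d - j)
      omega
    intro a ha b hb
    rw [this a ha, this b hb]

/-- A polynomial vanishing near one point is zero, so on a knot interval the support condition
becomes a condition on the piece. -/
lemma Ioo_subset_tsupport_iff (ht : StrictMono t) (p : ℤ × ℕ) (r : ℤ) :
    Set.Ioo (t r) (t (r + 1)) ⊆ tsupport (Q d t ν p.1 p.2) ↔ piece d t ν p r ≠ 0 := by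
  have hr : t r < t (r + 1) := ht (by simp)
  constructor
  · intro h h0
    obtain ⟨x, hx⟩ := Set.nonempty_Ioo.2 hr
    have : Q d t ν p.1 p.2 =ᶠ[nhds x] 0 := by
      filter_upwards [Ioo_mem_nhds hx.1 hx.2] with y hy
      rw [Q_eq_eval_piece ht (Set.Ioo_subset_Ico_self hy), h0, eval_zero, Pi.zero_apply]
    exact notMem_tsupport_iff_eventuallyEq.2 this (h hx)
  · intro h x hx
    by_contra hx'
    obtain ⟨s, hs, hs'⟩ := (notMem_tsupport_iff_eventuallyEq.1 hx').exists_mem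
    refine h (Polynomial.eq_zero_of_infinite_isRoot _ ?_)
    refine Set.Infinite.mono ?_
      (infinite_of_mem_nhds x (Filter.inter_mem hs (Ioo_mem_nhds hx.1 hx.2)))
    intro y hy
    have := hs' hy.1
    rwa [Q_eq_eval_piece ht (Set.Ioo_subset_Ico_self hy.2)] at this

end

/-! ### Smooth piecewise polynomials -/

/-- Sequences of polynomials of degree at most `d`, the `r`-th one thought of as living on
`[t r, t (r + 1))`, such that neighbours agree to order `e r` at `t r`. -/
def smoothPieces (d : ℕ) (e : ℤ → ℕ) (t : ℤ → ℝ) : Submodule ℝ (ℤ → ℝ[X]) where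
  carrier := {q | ∀ r, q r ∈ degreeLT ℝ (d + 1) ∧ (X - C (t r)) ^ e r ∣ q r - q (r - 1)}
  add_mem' := fun ha hb r => ⟨Submodule.add_mem _ (ha r).1 (hb r).1, by
    simpa [add_sub_add_comm] using dvd_add (ha r).2 (hb r).2⟩
  zero_mem' := fun r => ⟨Submodule.zero_mem _, by simp⟩
  smul_mem' := fun a q hq r => ⟨Submodule.smul_mem _ _ (hq r).1, by
    simpa [mul_sub, smul_eq_C_mul] using Dvd.dvd.mul_left (hq r).2 (C a)⟩

lemma mul_mem_smoothPieces {d : ℕ} {e : ℤ → ℕ} {t : ℤ → ℝ} {q q' : ℤ → ℝ[X]}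
    (hq : q ∈ smoothPieces d e t) (hq' : q' ∈ smoothPieces d e t) :
    q * q' ∈ smoothPieces (2 * d) e t := by
  intro r
  constructor
  · have h1 := (hq r).1
    have h2 := (hq' r).1
    have h : ∀ p : ℝ[X], ∀ n : ℕ, p ∈ degreeLT ℝ (n + 1) ↔ p.degree ≤ (n : WithBot ℕ) := by
      intro p n
      rw [mem_degreeLT]
      rcases eq_or_ne p 0 with rfl | hp
      · simp
      · rw [degree_eq_natDegree hp]
        norm_cast
        exact Nat.lt_succ_iff
    rw [h] at h1 h2 ⊢
    refine (degree_mul_le _ _).trans ((add_le_add h1 h2).trans_eq ?_)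
    rw [two_mul, Nat.cast_add]
  · have : (q * q') r - (q * q') (r - 1) =
        q r * (q' r - q' (r - 1)) + (q r - q (r - 1)) * q' (r - 1) := by
      simp only [Pi.mul_apply]; ring
    rw [this]
    exact dvd_add (Dvd.dvd.mul_left (hq' r).2 _) (Dvd.dvd.mul_right (hq r).2 _)

lemma exists_mem_knot_interval (t : ℤ → ℝ) {k : ℕ} (hk : 1 ≤ k) {x : ℝ}
    (hx : x ∈ Set.Icc (t 0) (t k)) : ∃ r : ℤ, 0 ≤ r ∧ r < k ∧ x ∈ Set.Icc (t r) (t (r + 1)) := by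
  induction k, hk using Nat.le_induction with
  | base => exact ⟨0, le_rfl, by simp, by simpa using hx⟩
  | succ k hk ih =>
    rcases le_total x (t k) with h | h
    · obtain ⟨r, h0, h1, h2⟩ := ih ⟨hx.1, h⟩
      exact ⟨r, h0, by push_cast; omega, h2⟩
    · exact ⟨k, by simp, by simp, h, by simpa using hx.2⟩

open scoped Classical in
/-- The index of a knot interval between `t 0` and `t k` that contains `x`. -/
def intervalIdx (t : ℤ → ℝ) (k : ℕ) (x : ℝ) : ℤ :=
  if h : ∃ r : ℤ, 0 ≤ r ∧ r < k ∧ x ∈ Set.Icc (t r) (t (r + 1)) then h.choose else 0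

lemma intervalIdx_spec (t : ℤ → ℝ) {k : ℕ} (hk : 1 ≤ k) {x : ℝ}
    (hx : x ∈ Set.Icc (t 0) (t k)) : 0 ≤ intervalIdx t k x ∧ intervalIdx t k x < k ∧
      x ∈ Set.Icc (t (intervalIdx t k x)) (t (intervalIdx t k x + 1)) := by
  have h := exists_mem_knot_interval t hk hx
  rw [intervalIdx, dif_pos h]
  exact h.choose_spec

/-- The piecewise polynomial function on `[t 0, t k]` with given pieces. -/
def glue (t : ℤ → ℝ) (k : ℕ) : (ℤ → ℝ[X]) →ₗ[ℝ] (Set.Icc (t 0) (t k) → ℝ) where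
  toFun q x := (q (intervalIdx t k x)).eval (x : ℝ)
  map_add' q q' := by ext x; simp
  map_smul' a q := by ext x; simp

lemma glue_congr (t : ℤ → ℝ) {k : ℕ} (hk : 1 ≤ k) {q q' : ℤ → ℝ[X]}
    (h : ∀ r : ℤ, 0 ≤ r → r < k → q r = q' r) : glue t k q = glue t k q' := by
  ext x
  obtain ⟨h0, h1, -⟩ := intervalIdx_spec t hk x.2
  simp only [glue, LinearMap.coe_mk, AddHom.coe_mk, h _ h0 h1]

/-- `f` is given by the polynomials `q r` on the half-open knot intervals. -/
def HasPieces (t : ℤ → ℝ) (f : ℝ → ℝ) (q : ℤ → ℝ[X]) : Prop :=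
  ∀ r, ∀ x ∈ Set.Ico (t r) (t (r + 1)), f x = (q r).eval x

lemma HasPieces.mul {t : ℤ → ℝ} {f g : ℝ → ℝ} {q q' : ℤ → ℝ[X]} (hf : HasPieces t f q)
    (hg : HasPieces t g q') : HasPieces t (f * g) (q * q') := fun r x hx => by
  rw [Pi.mul_apply, Pi.mul_apply, eval_mul, hf r x hx, hg r x hx]

lemma HasPieces.domRestrict_eq {t : ℤ → ℝ} (ht : StrictMono t) {k : ℕ} (hk : 1 ≤ k) {f : ℝ → ℝ}
    {d : ℕ} {e : ℤ → ℕ} (he : ∀ r, 1 ≤ e r) {q : ℤ → ℝ[X]} (hf : HasPieces t f q)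
    (hq : q ∈ smoothPieces d e t) :
    (Set.Icc (t 0) (t k)).domRestrict f = glue t k q := by
  ext x
  obtain ⟨-, -, h1, h2⟩ := intervalIdx_spec t hk x.2
  simp only [Set.domRestrict_apply, glue, LinearMap.coe_mk, AddHom.coe_mk]
  set r := intervalIdx t k x
  rcases h2.lt_or_eq with h2 | h2
  · exact hf r x ⟨h1, h2⟩
  -- The chosen interval may have x as its right endpoint, where f is given by the next piece;
  -- positive contact order makes the two values equal.
  · rw [hf (r + 1) x ⟨h2.ge, by rw [h2]; exact ht (by simp)⟩]
    have h3 := (dvd_pow_self _ (by have := he (r + 1); omega)).trans (hq (r + 1)).2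
    rw [add_sub_cancel_right, dvd_iff_isRoot, IsRoot, eval_sub, sub_eq_zero] at h3
    rw [h2, h3]

lemma eq_zero_of_eval_eq_zero {a b : ℝ} (hab : a < b) {p : ℝ[X]}
    (h : ∀ x ∈ Set.Ioo a b, p.eval x = 0) : p = 0 :=
  Polynomial.eq_zero_of_infinite_isRoot _ ((Set.Ioo_infinite hab).mono h)

lemma apply_eq_zero_of_glue_eq_zero {t : ℤ → ℝ} (ht : StrictMono t) {k : ℕ} {q : ℤ → ℝ[X]}
    (h : glue t k q = 0) {r : ℤ} (h0 : 0 ≤ r) (hr : r < k) : q r = 0 := by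
  refine eq_zero_of_eval_eq_zero (ht (lt_add_one r)) fun x hx => ?_
  have hx' : x ∈ Set.Icc (t 0) (t k) :=
    ⟨(ht.monotone h0).trans hx.1.le, hx.2.le.trans (ht.monotone hr)⟩
  obtain ⟨-, -, h1, h2⟩ := intervalIdx_spec t (k := k) (by omega) hx'
  have h3 := congrFun h ⟨x, hx'⟩
  simp only [glue, LinearMap.coe_mk, AddHom.coe_mk, Pi.zero_apply] at h3
  have h4 := ht.lt_iff_lt.1 (h1.trans_lt hx.2)
  have h5 := ht.lt_iff_lt.1 (hx.1.trans_le h2)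
  rwa [show intervalIdx t k x = r by omega] at h3

/-- The multiples of (X - c)^e of degree at most d form a space of dimension d + 1 - e, which is the
size of the independent family. -/
lemma mem_span_of_pow_dvd {ι : Type*} [Fintype ι] {d e : ℕ} {c : ℝ} {b : ι → ℝ[X]}
    (hb : LinearIndependent ℝ b) (hdeg : ∀ i, b i ∈ degreeLT ℝ (d + 1))
    (hdvd : ∀ i, (X - C c) ^ e ∣ b i) (hcard : Fintype.card ι + e = d + 1) {p : ℝ[X]}
    (hp : p ∈ degreeLT ℝ (d + 1)) (hp' : (X - C c) ^ e ∣ p) :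
    p ∈ Submodule.span ℝ (Set.range b) := by
  set L := (degreeLT ℝ (d + 1 - e)).map (LinearMap.mulLeft ℝ ((X - C c) ^ e : ℝ[X])) with hL
  have key : ∀ p ∈ degreeLT ℝ (d + 1), (X - C c) ^ e ∣ p → p ∈ L := by
    rintro _ hp ⟨q, rfl⟩
    refine ⟨q, ?_, rfl⟩
    rcases eq_or_ne q 0 with rfl | hq
    · exact Submodule.zero_mem _
    · rw [mem_degreeLT, degree_mul, degree_pow, degree_X_sub_C, degree_eq_natDegree hq] at hp
      simp only [nsmul_eq_mul, mul_one] at hp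
      have hp : e + q.natDegree < d + 1 := by exact_mod_cast hp
      exact mem_degreeLT.2 (by rw [degree_eq_natDegree hq]; exact_mod_cast (by omega))
  have h := Submodule.eq_of_le_of_finrank_le (S₁ := Submodule.span ℝ (Set.range b)) (S₂ := L)
    (Submodule.span_le.2 (by rintro _ ⟨i, rfl⟩; exact key _ (hdeg i) (hdvd i))) (by
      rw [finrank_span_eq_card hb]
      refine (Submodule.finrank_map_le _ _).trans ?_
      rw [finrank_degreeLT_eq]; omega)
  rw [h]
  exact key p hp hp'

/-! ### Triangular families of smooth piecewise polynomials -/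

section
variable {d : ℕ} {e : ℤ → ℕ} {t : ℤ → ℝ} {k : ℕ} {ι : Fin k → Type} [∀ r, Fintype (ι r)]
  {G : ∀ r, ι r → ℤ → ℝ[X]}

/-- On interval n the later groups vanish and the earlier coefficients are already known to be zero,
so only group n is left. -/
lemma linearIndependent_glue (ht : StrictMono t)
    (hz : ∀ (r : Fin k) (i : ι r) (s : ℤ), 0 ≤ s → s < (r : ℕ) → G r i s = 0)
    (hli : ∀ r : Fin k, LinearIndependent ℝ fun i => G r i ((r : ℕ) : ℤ)) :
    LinearIndependent ℝ fun x : Σ r, ι r => glue t k (G x.1 x.2) := by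
  rw [Fintype.linearIndependent_iff]
  intro c hc
  have h1 : ∑ x : Σ r, ι r, c x • glue t k (G x.1 x.2) =
      glue t k (∑ x : Σ r, ι r, c x • G x.1 x.2) := by simp [map_sum]
  rw [h1] at hc
  suffices ∀ n (hn : n < k) (i : ι ⟨n, hn⟩), c ⟨⟨n, hn⟩, i⟩ = 0 from
    fun x => this x.1 x.1.2 x.2
  intro n
  induction n using Nat.strong_induction_on with
  | _ n ih =>
    intro hn
    have h2 := apply_eq_zero_of_glue_eq_zero ht hc (r := n) (by simp) (by exact_mod_cast hn)
    rw [Fintype.sum_sigma, Finset.sum_apply, Finset.sum_eq_single ⟨n, hn⟩] at h2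
    · simp only [Finset.sum_apply, Pi.smul_apply] at h2
      exact Fintype.linearIndependent_iff.1 (hli ⟨n, hn⟩) _ h2
    · intro r _ hr
      rw [Finset.sum_apply]
      refine Finset.sum_eq_zero fun i _ => ?_
      rw [Pi.smul_apply]
      rcases lt_trichotomy (r : ℕ) n with h | h | h
      · rw [ih r h r.2 i, zero_smul]
      · exact absurd (Fin.ext h) hr
      · rw [hz r i n (by simp) (by exact_mod_cast h), smul_zero]
    · simp

/-- The intervals are matched from left to right. What remains vanishes before t_n, so smoothness
makes its next piece divisible by (X - t_n)^(e n), and group n spans all such polynomials. For n = 0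
smoothness imposes nothing, as nothing is known to the left of t_0. -/
lemma span_range_glue (hk : 1 ≤ k)
    (hG : ∀ r i, G r i ∈ smoothPieces d e t)
    (hz : ∀ (r : Fin k) (i : ι r) (s : ℤ), 0 ≤ s → s < (r : ℕ) → G r i s = 0)
    (hli : ∀ r : Fin k, LinearIndependent ℝ fun i => G r i ((r : ℕ) : ℤ))
    (hcard : ∀ r : Fin k,
      Fintype.card (ι r) + (if (r : ℕ) = 0 then 0 else e ((r : ℕ) : ℤ)) = d + 1) :
    Submodule.span ℝ (Set.range fun x : Σ r, ι r => glue t k (G x.1 x.2)) =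
      (smoothPieces d e t).map (glue t k) := by
  have hrange : (Set.range fun x : Σ r, ι r => glue t k (G x.1 x.2)) =
      glue t k '' Set.range fun x : Σ r, ι r => G x.1 x.2 := by
    rw [← Set.range_comp]; rfl
  rw [hrange, ← Submodule.map_span]
  set N := Submodule.span ℝ (Set.range fun x : Σ r, ι r => G x.1 x.2) with hN
  have hNle : N ≤ smoothPieces d e t :=
    Submodule.span_le.2 (by rintro _ ⟨x, rfl⟩; exact hG _ _)
  refine le_antisymm (Submodule.map_mono hNle) ?_
  rintro _ ⟨q, hq, rfl⟩
  suffices ∀ n ≤ k, ∃ h ∈ N, ∀ s : ℤ, 0 ≤ s → s < n → q s = h s by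
    obtain ⟨h, hh, hqh⟩ := this k le_rfl
    exact ⟨h, hh, (glue_congr t hk hqh).symm⟩
  intro n
  induction n with
  | zero => exact fun _ => ⟨0, Submodule.zero_mem _, fun s h0 h1 => absurd h1 (by simpa using h0)⟩
  | succ n ih =>
    intro hn
    obtain ⟨h, hh, hqh⟩ := ih (by omega)
    set r : Fin k := ⟨n, hn⟩
    have hdvd : ∀ g ∈ smoothPieces d e t, (∀ s : ℤ, 0 ≤ s → s < n → g s = 0) →
        (X - C (t n)) ^ (if (r : ℕ) = 0 then 0 else e ((r : ℕ) : ℤ)) ∣ g n := by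
      intro g hg hg0
      split_ifs with h0
      · simp
      · have := (hg n).2
        rwa [hg0 (n - 1) (by dsimp only [r] at h0; omega) (by omega), sub_zero] at this
    have hsub : q - h ∈ smoothPieces d e t := Submodule.sub_mem _ hq (hNle hh)
    have hmem := mem_span_of_pow_dvd (c := t n) (hli r) (fun i => (hG r i _).1)
      (fun i => hdvd _ (hG r i) fun s h0 h1 => hz r i s h0 (by simpa [r] using h1)) (hcard r)
      (hsub n).1 (hdvd _ hsub fun s h0 h1 => by rw [Pi.sub_apply, hqh s h0 h1, sub_self])
    obtain ⟨c, hc⟩ := (Submodule.mem_span_range_iff_exists_fun ℝ).1 hmem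
    refine ⟨h + ∑ i, c i • G r i, Submodule.add_mem _ hh (Submodule.sum_mem _ fun i _ =>
      Submodule.smul_mem _ _ (Submodule.subset_span ⟨⟨r, i⟩, rfl⟩)), fun s h0 h1 => ?_⟩
    simp only [Pi.add_apply, Finset.sum_apply, Pi.smul_apply]
    rcases (show s ≤ n by push_cast at h1; omega).lt_or_eq with hs | rfl
    · rw [hqh s h0 hs, Finset.sum_eq_zero, add_zero]
      intro i _
      rw [hz r i s h0 (by simpa [r] using hs), smul_zero]
    · rw [hc, Pi.sub_apply]; ring

end

/-! ### The spline space -/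

section
variable {d : ℕ} {t : ℤ → ℝ} {ν : ℤ → ℕ}

lemma hasPieces_Q (ht : StrictMono t) (d : ℕ) (ν : ℤ → ℕ) (p : ℤ × ℕ) :
    HasPieces t (Q d t ν p.1 p.2) (piece d t ν p) :=
  fun _ _ hx => Q_eq_eval_piece ht hx

lemma piece_mem_smoothPieces (ht : StrictMono t) (hν : ∀ i, 1 ≤ ν i) {p : ℤ × ℕ}
    (hp : IsKnot ν p) : piece d t ν p ∈ smoothPieces d (fun r => d + 1 - ν r) t :=
  fun r => ⟨piece_mem_degreeLT _ _ _ _ _, dvd_piece_sub ht hν hp r⟩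

lemma mem_Ico_of_Q_ne_zero (ht : StrictMono t) {i : ℤ} {l : ℕ} {x : ℝ} (h : Q d t ν i l x ≠ 0) :
    x ∈ Set.Ico (t i) (t (i + (d + 1))) := by
  rw [Q, knotsFrom_eq_knots, bspline_eq_eval d (monotone_knots ht _)] at h
  by_contra hx
  rw [Set.mem_Ico, not_and_or, not_le, not_lt] at hx
  refine h ?_
  rcases hx with hx | hx
  · rw [coxDeBoor_eq_zero (a := 0), eval_zero]
    exact fun j _ => if_neg (not_le.2 (hx.trans_le (monotone_knots ht (i, l) j.zero_le)))
  · rw [coxDeBoor_eq_zero (a := 1), eval_zero]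
    refine fun j hj => if_pos ((ht.monotone ?_).trans hx)
    refine (monotone_iterate_next (i, l) hj).trans ?_
    simpa using iterate_next_fst_le (ν := ν) (i, l) (d + 1)

lemma finite_support_sum_Q (ht : StrictMono t) (d : ℕ) (ν : ℤ → ℕ) (c : ℤ → ℕ → ℝ) (x : ℝ) :
    (Function.support fun i => ∑ l ∈ Finset.Icc 1 (ν i), c i l * Q d t ν i l x).Finite := by
  have h : ∀ i, (∑ l ∈ Finset.Icc 1 (ν i), c i l * Q d t ν i l x) ≠ 0 →
      x ∈ Set.Ico (t i) (t (i + (d + 1))) := by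
    intro i hi
    obtain ⟨l, -, hl⟩ := Finset.exists_ne_zero_of_sum_ne_zero hi
    exact mem_Ico_of_Q_ne_zero ht (right_ne_zero_of_mul hl)
  rcases Set.eq_empty_or_nonempty
    (Function.support fun i => ∑ l ∈ Finset.Icc 1 (ν i), c i l * Q d t ν i l x) with h0 | ⟨i, hi⟩
  · rw [h0]; exact Set.finite_empty
  · refine (Set.finite_Icc (i - (d + 1)) (i + (d + 1))).subset fun j hj => ?_
    have h1 := h i hi
    have h2 := h j hj
    have h3 := ht.lt_iff_lt.1 (h1.1.trans_lt h2.2)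
    have h4 := ht.lt_iff_lt.1 (h2.1.trans_lt h1.2)
    exact ⟨by omega, by omega⟩

/-- The spline space as a submodule. -/
def splineSubmodule (ht : StrictMono t) (d : ℕ) (ν : ℤ → ℕ) : Submodule ℝ (ℝ → ℝ) where
  carrier := splineSpace d t ν
  add_mem' := by
    rintro _ _ ⟨c, rfl⟩ ⟨c', rfl⟩
    refine ⟨fun i l => c i l + c' i l, ?_⟩
    funext x
    rw [Pi.add_apply, ← finsum_add_distrib (finite_support_sum_Q ht d ν c x)
      (finite_support_sum_Q ht d ν c' x)]
    simp only [add_mul, Finset.sum_add_distrib]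
  zero_mem' := ⟨fun _ _ => 0, by funext x; simp⟩
  smul_mem' := by
    rintro a _ ⟨c, rfl⟩
    refine ⟨fun i l => a * c i l, ?_⟩
    funext x
    rw [Pi.smul_apply, smul_finsum' _ (finite_support_sum_Q ht d ν c x)]
    simp only [smul_eq_mul, Finset.mul_sum, mul_assoc]

lemma Q_mem_splineSubmodule (ht : StrictMono t) {p : ℤ × ℕ} (hp : IsKnot ν p) :
    Q d t ν p.1 p.2 ∈ splineSubmodule ht d ν := by
  refine ⟨fun i l => if (i, l) = p then 1 else 0, ?_⟩
  funext x
  rw [finsum_eq_single _ p.1]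
  · rw [Finset.sum_eq_single p.2]
    · simp
    · intro l _ hl
      dsimp only
      rw [if_neg (fun h => hl (congrArg Prod.snd h)), zero_mul]
    · intro h
      exact absurd (Finset.mem_Icc.2 hp) h
  · intro i hi
    refine Finset.sum_eq_zero fun l _ => ?_
    dsimp only
    rw [if_neg (fun h => hi (congrArg Prod.fst h)), zero_mul]

lemma exists_hasPieces (ht : StrictMono t) (hν : ∀ i, 1 ≤ ν i) {f : ℝ → ℝ}
    (hf : f ∈ splineSpace d t ν) :
    ∃ q ∈ smoothPieces d (fun r => d + 1 - ν r) t, HasPieces t f q := by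
  obtain ⟨c, rfl⟩ := hf
  have hfin : ∀ r, (Function.support fun i =>
      ∑ l ∈ Finset.Icc 1 (ν i), c i l • piece d t ν (i, l) r).Finite := by
    refine fun r => (Set.finite_Icc (r - (d + 1)) r).subset fun i hi => ?_
    obtain ⟨l, -, hl⟩ := Finset.exists_ne_zero_of_sum_ne_zero hi
    have hl := right_ne_zero_of_smul hl
    constructor
    · by_contra h
      exact hl (piece_eq_zero_of_add_le ht (by dsimp only; omega))
    · by_contra h
      exact hl (piece_eq_zero_of_lt ht (by dsimp only; omega))
  refine ⟨fun r => ∑ᶠ i, ∑ l ∈ Finset.Icc 1 (ν i), c i l • piece d t ν (i, l) r,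
    fun r => ⟨?_, ?_⟩, fun r x hx => ?_⟩
  · refine finsum_induction (· ∈ degreeLT ℝ (d + 1)) (Submodule.zero_mem _)
      (fun _ _ => Submodule.add_mem _) fun i => Submodule.sum_mem _ fun l _ =>
        Submodule.smul_mem _ _ (piece_mem_degreeLT _ _ _ _ _)
  · dsimp only
    rw [← finsum_sub_distrib (hfin r) (hfin (r - 1))]
    refine finsum_induction (_ ∣ ·) (dvd_zero _) (fun _ _ => dvd_add) fun i => ?_
    rw [← Finset.sum_sub_distrib]
    refine Finset.dvd_sum fun l hl => ?_
    rw [← smul_sub, smul_eq_C_mul]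
    exact Dvd.dvd.mul_left (dvd_piece_sub ht hν (p := (i, l)) (Finset.mem_Icc.1 hl) r) _
  · have := (leval x : ℝ[X] →ₗ[ℝ] ℝ).toAddMonoidHom.map_finsum (hfin r)
    simp only [LinearMap.toAddMonoidHom_coe, leval_apply] at this
    rw [this]
    refine finsum_congr fun i => ?_
    rw [eval_finsetSum]
    refine Finset.sum_congr rfl fun l _ => ?_
    rw [eval_smul, smul_eq_mul, Q_eq_eval_piece ht hx]

lemma piece_eq_of_Q_eq (ht : StrictMono t) {p p' : ℤ × ℕ}
    (h : Q d t ν p.1 p.2 = Q d t ν p'.1 p'.2) (r : ℤ) :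
    piece d t ν p r = piece d t ν p' r := by
  rw [← sub_eq_zero]
  refine eq_zero_of_eval_eq_zero (ht (lt_add_one r)) fun x hx => ?_
  have hx := Set.Ioo_subset_Ico_self hx
  rw [eval_sub, ← hasPieces_Q ht d ν p r x hx, ← hasPieces_Q ht d ν p' r x hx, h, sub_self]

/-- Splines restricted to `[t 0, t k]` are exactly the piecewise polynomials with the prescribed
smoothness at the interior knots. -/
lemma domRestrict_image_splineSpace (ht : StrictMono t) (hν : ∀ i, 1 ≤ ν i ∧ ν i ≤ d) {k : ℕ}
    (hk : 1 ≤ k) :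
    (Set.Icc (t 0) (t k)).domRestrict '' splineSpace d t ν =
      (smoothPieces d (fun r => d + 1 - ν r) t).map (glue t k) := by
  have hν1 : ∀ i, 1 ≤ ν i := fun i => (hν i).1
  have he : ∀ r, 1 ≤ d + 1 - ν r := fun r => by have := (hν r).2; omega
  refine Set.Subset.antisymm ?_ ?_
  · rintro _ ⟨f, hf, rfl⟩
    obtain ⟨q, hq, hfq⟩ := exists_hasPieces ht hν1 hf
    exact ⟨q, hq, (hfq.domRestrict_eq ht hk he hq).symm⟩
  -- Group 0 holds all d + 1 B-splines active on the first interval; group r > 0 holds the ν r ones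
  -- starting at t_r.
  · have hle : ∀ r : Fin k, (if (r : ℕ) = 0 then d + 1 else ν ((r : ℕ) : ℤ)) ≤ d + 1 := by
      intro r; have := (hν ((r : ℕ) : ℤ)).2; split_ifs <;> omega
    have h := span_range_glue (d := d) (e := fun r => d + 1 - ν r) (t := t) (k := k)
      (ι := fun r => Fin (if (r : ℕ) = 0 then d + 1 else ν ((r : ℕ) : ℤ)))
      (G := fun r n => piece d t ν (activeIdx ν ((r : ℕ) : ℤ) n)) hk
      (fun r n => piece_mem_smoothPieces ht hν1 (isKnot_activeIdx hν1 _ _))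
      (fun r n s h0 h1 => piece_eq_zero_of_lt ht (by
        have hn : (n : ℕ) < ν ((r : ℕ) : ℤ) := n.2.trans_eq (if_neg (by omega))
        rw [activeIdx_of_lt hn]
        exact h1))
      (fun r => (linearIndependent_piece ht hν1 d ((r : ℕ) : ℤ)).comp (Fin.castLE (hle r))
        (Fin.castLE_injective _))
      (fun r => by
        have := (hν ((r : ℕ) : ℤ)).2
        simp only [Fintype.card_fin]
        split_ifs <;> omega)
    rw [← h]
    have hspan : Submodule.span ℝ (Set.range fun x : Σ r : Fin k,
        Fin (if (r : ℕ) = 0 then d + 1 else ν ((r : ℕ) : ℤ)) =>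
          glue t k (piece d t ν (activeIdx ν ((x.1 : ℕ) : ℤ) x.2))) ≤
        (splineSubmodule ht d ν).map (LinearMap.funLeft ℝ ℝ
          (Subtype.val : Set.Icc (t 0) (t k) → ℝ)) := by
      refine Submodule.span_le.2 ?_
      rintro _ ⟨x, rfl⟩
      have hx := isKnot_activeIdx hν1 ((x.1 : ℕ) : ℤ) x.2
      exact ⟨_, Q_mem_splineSubmodule ht hx, (hasPieces_Q ht d ν _).domRestrict_eq ht hk he
        (piece_mem_smoothPieces ht hν1 hx)⟩
    intro g hg
    obtain ⟨f, hf, rfl⟩ := hspan hg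
    exact ⟨f, hf, rfl⟩

end

/-! ### Products of pairs of B-splines -/

lemma linearIndependent_mul_sumElim {m : ℕ} {a : Fin (m + 1) → ℝ[X]} (ha : LinearIndependent ℝ a)
    (hdeg : ∀ n, a n ∈ degreeLT ℝ (m + 1)) {α β x₀ x₁ : ℝ} (hα : α ≠ 0) (hβ : β ≠ 0) (hx : x₀ ≠ x₁)
    (h0 : a 0 = α • (X - C x₀) ^ m) (h1 : a (Fin.last m) = β • (X - C x₁) ^ m) :
    LinearIndependent ℝ (Sum.elim (fun n => a (Fin.last m) * a n)
      (fun n : Fin m => a 0 * a n.castSucc)) := by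
  rw [Fintype.linearIndependent_iff]
  intro c hc
  rw [Fintype.sum_sum_type] at hc
  simp only [Sum.elim_inl, Sum.elim_inr, ← mul_smul_comm, ← Finset.mul_sum] at hc
  set p := ∑ n, c (Sum.inl n) • a n with hp
  set q := ∑ n : Fin m, c (Sum.inr n) • a n.castSucc with hq
  have ha0 : ∀ n, a n ≠ 0 := ha.ne_zero
  have hcop : IsCoprime ((X - C x₁) ^ m) (a 0) := by
    rw [h0, smul_eq_C_mul]
    refine IsCoprime.mul_right ?_ (IsCoprime.pow (isCoprime_X_sub_C_of_isUnit_sub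
      (sub_ne_zero.2 hx.symm).isUnit))
    exact isCoprime_one_right.of_isCoprime_of_dvd_right
      ((isUnit_C.2 hα.isUnit).dvd)
  have hdvd : (X - C x₁) ^ m ∣ q := by
    refine hcop.dvd_of_dvd_mul_left ?_
    rw [eq_neg_of_add_eq_zero_right hc, h1, dvd_neg, smul_mul_assoc, smul_eq_C_mul]
    exact Dvd.dvd.mul_left (dvd_mul_right _ _) _
  have hqdeg : q ∈ degreeLT ℝ (m + 1) :=
    Submodule.sum_mem _ fun n _ => Submodule.smul_mem _ _ (hdeg _)
  obtain ⟨γ, hγ⟩ : ∃ γ : ℝ, q = γ • a (Fin.last m) := by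
    rcases eq_or_ne q 0 with h | h
    · exact ⟨0, by rw [h, zero_smul]⟩
    · obtain ⟨δ, -, hδ⟩ := eq_smul_of_pow_dvd hqdeg h hdvd
      exact ⟨δ / β, by rw [h1, smul_smul, div_mul_cancel₀ _ hβ, hδ]⟩
  -- The equation q = γ · a_m is a relation among all the a_n, with coefficient -γ at the last one,
  -- which q does not involve.
  have hsum : ∑ n : Fin (m + 1), (Fin.snoc (α := fun _ => ℝ) (fun n => c (Sum.inr n)) (-γ) :
      Fin (m + 1) → ℝ) n • a n = 0 := by
    rw [Fin.sum_univ_castSucc]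
    simp only [Fin.snoc_castSucc, Fin.snoc_last]
    rw [← hq, hγ, neg_smul, add_neg_cancel]
  have hr := Fintype.linearIndependent_iff.1 ha _ hsum
  have hr' : ∀ n : Fin m, c (Sum.inr n) = 0 := fun n => by
    simpa only [Fin.snoc_castSucc] using hr n.castSucc
  have hq0 : q = 0 := by simp [hq, hr']
  rw [hq0, mul_zero, add_zero, mul_eq_zero, or_iff_right (ha0 _)] at hc
  rintro (n | n)
  · exact Fintype.linearIndependent_iff.1 ha _ hc n
  · exact hr' n

section
variable {m : ℕ} {t : ℤ → ℝ} {μ : ℤ → ℕ} {k : ℕ}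

/-- The number of products in `prodFamily` that involve `R (r + 1)` on `(t r, t (r + 1))`. -/
def firstCount (m : ℕ) (μ : ℤ → ℕ) (r : ℕ) : ℕ := if r = 0 then m + 1 else μ r

lemma firstCount_le (hμ : ∀ i, 1 ≤ μ i ∧ μ i ≤ m) (r : ℕ) : firstCount m μ r ≤ m + 1 := by
  have := (hμ r).2
  rw [firstCount]; split_ifs <;> omega

lemma firstCount_of_pos {r : ℕ} (hr : 0 < r) : firstCount m μ r = μ r := if_neg hr.ne'

/-- Indices for `prodFamily`. -/
abbrev ProdIdx (m : ℕ) (μ : ℤ → ℕ) (k : ℕ) : Type :=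
  Σ r : Fin k, Fin (firstCount m μ r) ⊕ Fin m

/-- The two indices of B-splines in a product in `prodFamily`. -/
def prodPair (m : ℕ) (μ : ℤ → ℕ) (r : ℕ) :
    Fin (firstCount m μ r) ⊕ Fin m → (ℤ × ℕ) × (ℤ × ℕ) :=
  Sum.elim (fun n => (activeIdx μ r m, activeIdx μ r n))
    (fun n => (activeIdx μ r 0, activeIdx μ r n))

/-- The elements of `prodFamily`. -/
def prodFun (m : ℕ) (t : ℤ → ℝ) (μ : ℤ → ℕ) (k : ℕ) (x : ProdIdx m μ k) : ℝ → ℝ :=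
  Q m t μ (prodPair m μ x.1 x.2).1.1 (prodPair m μ x.1 x.2).1.2 *
    Q m t μ (prodPair m μ x.1 x.2).2.1 (prodPair m μ x.1 x.2).2.2

/-- The pieces of the elements of `prodFamily`. -/
def prodPiece (m : ℕ) (t : ℤ → ℝ) (μ : ℤ → ℕ) (r : ℕ) (i : Fin (firstCount m μ r) ⊕ Fin m) :
    ℤ → ℝ[X] :=
  piece m t μ (prodPair m μ r i).1 * piece m t μ (prodPair m μ r i).2

lemma isKnot_prodPair (hμ : ∀ i, 1 ≤ μ i) (r : ℕ) (i : Fin (firstCount m μ r) ⊕ Fin m) :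
    IsKnot μ (prodPair m μ r i).1 ∧ IsKnot μ (prodPair m μ r i).2 := by
  rcases i with n | n <;> exact ⟨isKnot_activeIdx hμ _ _, isKnot_activeIdx hμ _ _⟩

lemma prodPiece_mem (ht : StrictMono t) (hμ : ∀ i, 1 ≤ μ i) (r : ℕ)
    (i : Fin (firstCount m μ r) ⊕ Fin m) :
    prodPiece m t μ r i ∈ smoothPieces (2 * m) (fun r => m + 1 - μ r) t :=
  mul_mem_smoothPieces (piece_mem_smoothPieces ht hμ (isKnot_prodPair hμ r i).1)
    (piece_mem_smoothPieces ht hμ (isKnot_prodPair hμ r i).2)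

/-- R_{r+1} may reach to the left of t_r, but for r > 0 its partner starts at t_r; in the other
products Q_{r,1} does. -/
lemma prodPiece_eq_zero (ht : StrictMono t) (r : ℕ)
    (i : Fin (firstCount m μ r) ⊕ Fin m) (s : ℤ) (h0 : 0 ≤ s) (hs : s < r) :
    prodPiece m t μ r i s = 0 := by
  rcases i with n | n
  · refine mul_eq_zero_of_right _ (piece_eq_zero_of_lt ht ?_)
    have hn := n.2.trans_eq (firstCount_of_pos (by omega))
    simpa [prodPair, activeIdx_of_lt hn] using hs
  · exact mul_eq_zero_of_left (piece_eq_zero_of_lt ht hs) _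

lemma linearIndependent_prodPiece (ht : StrictMono t) (hμ : ∀ i, 1 ≤ μ i ∧ μ i ≤ m) (r : ℕ) :
    LinearIndependent ℝ fun i => prodPiece m t μ r i r := by
  have hμ1 : ∀ i, 1 ≤ μ i := fun i => (hμ i).1
  obtain ⟨α, hα, h0⟩ := piece_activeIdx_zero ht hμ1 m r
  obtain ⟨β, hβ, h1⟩ := piece_activeIdx_last ht hμ1 m r
  have h := linearIndependent_mul_sumElim (linearIndependent_piece ht hμ1 m r)
    (fun n => piece_mem_degreeLT _ _ _ _ _) hα hβ (ht (lt_add_one (r : ℤ))).ne h0 h1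
  convert h.comp (Sum.map (Fin.castLE (firstCount_le hμ r)) id)
    ((Fin.castLE_injective _).sumMap Function.injective_id) using 1
  funext i
  rcases i with n | n <;> simp [prodPiece, prodPair]

lemma card_prodIdx_fiber (hμ : ∀ i, 1 ≤ μ i ∧ μ i ≤ m) (r : ℕ) :
    Fintype.card (Fin (firstCount m μ r) ⊕ Fin m) + (if r = 0 then 0 else m + 1 - μ r) =
      2 * m + 1 := by
  have := (hμ r).2
  rw [Fintype.card_sum, Fintype.card_fin, Fintype.card_fin, firstCount]
  split_ifs <;> omega

lemma domRestrict_prodFun (ht : StrictMono t) (hμ : ∀ i, 1 ≤ μ i ∧ μ i ≤ m) (hk : 1 ≤ k)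
    (x : ProdIdx m μ k) :
    (Set.Icc (t 0) (t k)).domRestrict (prodFun m t μ k x) = glue t k (prodPiece m t μ x.1 x.2) :=
  ((hasPieces_Q ht m μ _).mul (hasPieces_Q ht m μ _)).domRestrict_eq ht hk
    (fun r => by have := (hμ r).2; omega) (prodPiece_mem ht (fun i => (hμ i).1) x.1 x.2)

lemma linearIndependent_prodFun (ht : StrictMono t) (hμ : ∀ i, 1 ≤ μ i ∧ μ i ≤ m) (hk : 1 ≤ k) :
    LinearIndependent ℝ fun x => (Set.Icc (t 0) (t k)).domRestrict (prodFun m t μ k x) := by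
  simp only [domRestrict_prodFun ht hμ hk]
  exact linearIndependent_glue (ι := fun r : Fin k => Fin (firstCount m μ r) ⊕ Fin m)
    (G := fun r => prodPiece m t μ r) ht (fun r => prodPiece_eq_zero ht r)
    fun r => linearIndependent_prodPiece ht hμ r

lemma span_prodFun (ht : StrictMono t) (hμ : ∀ i, 1 ≤ μ i ∧ μ i ≤ m) (hk : 1 ≤ k) :
    Submodule.span ℝ
      (Set.range fun x => (Set.Icc (t 0) (t k)).domRestrict (prodFun m t μ k x)) =
      (smoothPieces (2 * m) (fun r => m + 1 - μ r) t).map (glue t k) := by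
  simp only [domRestrict_prodFun ht hμ hk]
  exact span_range_glue (ι := fun r : Fin k => Fin (firstCount m μ r) ⊕ Fin m)
    (G := fun r => prodPiece m t μ r) hk
    (fun r => prodPiece_mem ht (fun i => (hμ i).1) r) (fun r => prodPiece_eq_zero ht r)
    (fun r => linearIndependent_prodPiece ht hμ r) fun r => card_prodIdx_fiber hμ r

/-- Being active on (t_r, t_{r+1}) means having an index n ≤ m there, and n = m is R_{r+1}. So the
condition Q_{j,l} ≠ R_{r+1} says n < m. -/
lemma range_prodFun (ht : StrictMono t) (hμ : ∀ i, 1 ≤ μ i ∧ μ i ≤ m) (hk : 1 ≤ k) :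
    Set.range (prodFun m t μ k) = prodFamily m t μ k := by
  have hμ1 : ∀ i, 1 ≤ μ i := fun i => (hμ i).1
  have hQ1 : ∀ i : ℤ, Q m t μ i 1 = Q m t μ (activeIdx μ i 0).1 (activeIdx μ i 0).2 :=
    fun i => rfl
  have hR1 : R m t μ 1 = Q m t μ (activeIdx μ 0 m).1 (activeIdx μ 0 m).2 :=
    R_eq_Q hμ1 m t 0
  have hsupp : ∀ (r : ℤ) (n : ℕ), n ≤ m → Set.Ioo (t r) (t (r + 1)) ⊆
      tsupport (Q m t μ (activeIdx μ r n).1 (activeIdx μ r n).2) := fun r n hn =>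
    (Ioo_subset_tsupport_iff ht _ r).2 (piece_activeIdx_ne_zero ht hμ1 r hn)
  refine Set.Subset.antisymm ?_ ?_
  · rintro _ ⟨⟨r, n | n⟩, rfl⟩
    · have hn := n.2
      rcases Nat.eq_zero_or_pos (r : ℕ) with hr | hr
      · refine Or.inl (Or.inl ⟨(activeIdx μ 0 n).1, (activeIdx μ 0 n).2,
          (isKnot_activeIdx hμ1 _ _).1, (isKnot_activeIdx hμ1 _ _).2,
          hsupp 0 n (Nat.lt_succ_iff.1 (hn.trans_le (firstCount_le hμ _))), ?_⟩)
        rw [hR1]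
        simp [prodFun, prodPair, hr]
      · have hn := hn.trans_eq (firstCount_of_pos hr)
        refine Or.inr ⟨(r : ℕ), n + 1, by omega, by omega, by omega, by omega, ?_⟩
        rw [R_eq_Q hμ1]
        simp [prodFun, prodPair, activeIdx_of_lt hn]
    · refine Or.inl (Or.inr ⟨(r : ℕ), (activeIdx μ (r : ℕ) n).1, (activeIdx μ (r : ℕ) n).2,
        by omega, by omega, (isKnot_activeIdx hμ1 _ _).1, (isKnot_activeIdx hμ1 _ _).2, ?_,
        hsupp _ n n.2.le, rfl⟩)
      rw [R_eq_Q hμ1]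
      intro h
      have := activeIdx_piece_injective ht hμ1 _ n.2.le le_rfl (piece_eq_of_Q_eq ht h (r : ℕ))
      omega
  · rintro _ ((⟨i, l, h1, h2, h3, rfl⟩ | ⟨i, j, l, h0, h1, h2, h3, h4, h5, rfl⟩) |
      ⟨i, l, h0, h1, h2, h3, rfl⟩)
    · obtain ⟨n, hn, hp⟩ := exists_eq_activeIdx ht hμ1 (p := (i, l)) ⟨h1, h2⟩
        ((Ioo_subset_tsupport_iff ht (i, l) 0).1 h3)
      refine ⟨⟨⟨0, hk⟩, Sum.inl ⟨n, ?_⟩⟩, ?_⟩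
      · simp [firstCount]; omega
      · rw [hR1]
        simp [prodFun, prodPair, ← hp]
    · lift i to ℕ using h0
      obtain ⟨n, hn, hp⟩ := exists_eq_activeIdx ht hμ1 (p := (j, l)) ⟨h2, h3⟩
        ((Ioo_subset_tsupport_iff ht (j, l) i).1 h5)
      have hnm : n ≠ m := by
        rintro rfl
        exact h4 (by rw [R_eq_Q hμ1, ← hp])
      refine ⟨⟨⟨i, by omega⟩, Sum.inr ⟨n, by omega⟩⟩, ?_⟩
      rw [hQ1]
      simp [prodFun, prodPair, ← hp]
    · lift i to ℕ using (by omega)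
      obtain ⟨n, rfl⟩ := Nat.exists_eq_add_of_le' h2
      refine ⟨⟨⟨i, by omega⟩, Sum.inl ⟨n, ?_⟩⟩, ?_⟩
      · rw [firstCount_of_pos (by dsimp only; omega)]; exact h3
      · rw [R_eq_Q hμ1]
        simp [prodFun, prodPair, activeIdx_of_lt (show n < μ i from h3)]

lemma spanSq_eq (ht : StrictMono t) (hμ : ∀ i, 1 ≤ μ i ∧ μ i ≤ m) (hk : 1 ≤ k) :
    spanSq m t μ k = (smoothPieces (2 * m) (fun r => m + 1 - μ r) t).map (glue t k) := by
  have hμ1 : ∀ i, 1 ≤ μ i := fun i => (hμ i).1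
  refine le_antisymm (Submodule.span_le.2 ?_) ?_
  · rintro _ ⟨f, hf, rfl⟩
    obtain ⟨q, hq, hfq⟩ := exists_hasPieces ht hμ1 hf
    refine ⟨q * q, mul_mem_smoothPieces hq hq, ?_⟩
    rw [← (hfq.mul hfq).domRestrict_eq ht hk (fun r => by have := (hμ r).2; omega)
      (mul_mem_smoothPieces hq hq)]
    ext x
    simp [sq]
  · rw [← span_prodFun ht hμ hk, Submodule.span_le]
    rintro _ ⟨x, rfl⟩
    obtain ⟨h1, h2⟩ := isKnot_prodPair hμ1 x.1 x.2
    have hf := Q_mem_splineSubmodule (d := m) ht h1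
    have hg := Q_mem_splineSubmodule (d := m) ht h2
    change (Set.Icc (t 0) (t k)).domRestrict (prodFun m t μ k x) ∈ spanSq m t μ k
    rw [prodFun]
    set f := Q m t μ (prodPair m μ x.1 x.2).1.1 (prodPair m μ x.1 x.2).1.2
    set g := Q m t μ (prodPair m μ x.1 x.2).2.1 (prodPair m μ x.1 x.2).2.2
    have hsq : ∀ f ∈ splineSubmodule ht m μ,
        (Set.Icc (t 0) (t k)).domRestrict (fun x => |f x| ^ 2) ∈ spanSq m t μ k :=
      fun f hf => Submodule.subset_span ⟨f, hf, rfl⟩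
    -- Polarization: fg = ((f + g)² - f² - g²) / 2.
    have h := Submodule.smul_mem _ (2⁻¹ : ℝ) (Submodule.sub_mem _ (Submodule.sub_mem _
      (hsq _ (Submodule.add_mem _ hf hg)) (hsq f hf)) (hsq g hg))
    convert h using 1
    ext x
    simp only [Set.domRestrict_apply, Pi.smul_apply, Pi.sub_apply, Pi.add_apply, Pi.mul_apply,
      sq_abs, smul_eq_mul]
    ring

lemma card_prodIdx (hk : 1 ≤ k) :
    Fintype.card (ProdIdx m μ k) = m * (k + 1) + 1 + ∑ i ∈ Finset.Ico 1 k, μ (i : ℤ) := by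
  simp only [ProdIdx, Fintype.card_sigma, Fintype.card_sum, Fintype.card_fin,
    Finset.sum_add_distrib, Finset.sum_const, Finset.card_univ, smul_eq_mul]
  rw [Fin.sum_univ_eq_sum_range (fun r => firstCount m μ r), Finset.range_eq_Ico,
    Finset.sum_eq_sum_Ico_succ_bot hk, Finset.sum_congr rfl fun r hr =>
      firstCount_of_pos (Finset.mem_Ico.1 hr).1]
  simp only [firstCount, if_true]
  ring

end

end

end SplineSquares

/-! ### Basis, dimension and the spline space of degree 2m -/

open SplineSquares in
theorem lemma3p2 (m k : ℕ) (hm : 1 ≤ m) (hk : 1 ≤ k)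
    (t : ℤ → ℝ) (ht : StrictMono t)
    (μ : ℤ → ℕ) (hμ : ∀ i, 1 ≤ μ i ∧ μ i ≤ m) :
    (∃ b : Module.Basis (SplineSquares.prodFamily m t μ k) ℝ (SplineSquares.spanSq m t μ k),
      ∀ p, (b p : Set.Icc (t 0) (t k) → ℝ) = (Set.Icc (t 0) (t k)).domRestrict (p : ℝ → ℝ)) ∧
    (Module.finrank ℝ (SplineSquares.spanSq m t μ k)
        = m * (k + 1) + 1 + ∑ i ∈ Finset.Ico 1 k, μ (i : ℤ) ∧
      m * (k + 1) + 1 + ∑ i ∈ Finset.Ico 1 k, μ (i : ℤ)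
        = 2 * m + 1 + ∑ i ∈ Finset.Ico 1 k, (m + μ (i : ℤ))) ∧
    (SplineSquares.spanSq m t μ k : Set (Set.Icc (t 0) (t k) → ℝ))
      = (Set.Icc (t 0) (t k)).domRestrict ''
          SplineSquares.splineSpace (2 * m) t (fun i => m + μ i) := by
  have hli := linearIndependent_prodFun ht hμ hk
  have hspan := (span_prodFun ht hμ hk).trans (spanSq_eq ht hμ hk).symm
  let b₀ : Module.Basis (ProdIdx m μ k) ℝ (spanSq m t μ k) :=
    (Module.Basis.span hli).map (LinearEquiv.ofEq _ _ hspan)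
  have hb₀ : ∀ x, (b₀ x : Set.Icc (t 0) (t k) → ℝ) =
      (Set.Icc (t 0) (t k)).domRestrict (prodFun m t μ k x) := fun x => by
    simp [b₀, Module.Basis.span_apply]
  -- The restrictions are independent, hence distinct, so the products can be indexed by the set P_k
  -- itself.
  have hinj : Function.Injective (prodFun m t μ k) := fun x y h =>
    hli.injective (congrArg (Set.Icc (t 0) (t k)).domRestrict h)
  let σ : ProdIdx m μ k ≃ prodFamily m t μ k :=
    (Equiv.ofInjective _ hinj).trans (Equiv.setCongr (range_prodFun ht hμ hk))
  refine ⟨⟨b₀.reindex σ, fun p => ?_⟩, ⟨?_, ?_⟩, ?_⟩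
  · obtain ⟨x, rfl⟩ := σ.surjective p
    rw [Module.Basis.reindex_apply, Equiv.symm_apply_apply, hb₀]
    rfl
  · rw [Module.finrank_eq_card_basis b₀, card_prodIdx hk]
  · obtain ⟨k, rfl⟩ := Nat.exists_eq_add_of_le' hk
    simp only [Finset.sum_add_distrib, Finset.sum_const, Nat.card_Ico, smul_eq_mul,
      Nat.add_sub_cancel]
    ring
  · rw [domRestrict_image_splineSpace ht (fun i => by have := hμ i; omega) hk,
      spanSq_eq ht hμ hk]
    -- Raising the degree and all multiplicities by m leaves the contact orders unchanged.
    have : ∀ r, 2 * m + 1 - (m + μ r) = m + 1 - μ r := fun r => by omega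
    simp only [this]
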